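/- Let $n\in\mathbb N$, $n\ge 1$, $Y=(0,1)^n$, and let $A\in L^\infty_{\mathrm{per}}(Y;\mathbb R^{n\times n}_{\mathrm{sym}})$ and $b\in L^\infty_{\mathrm{per}}(Y;\mathbb R^n)$ be $Y$-periodic with $\lambda I_n\le A\le\Lambda I_n$ a.e. for some $\lambda,\Lambda>0$. Suppose that for some $\delta\in\left(\frac{n}{n+\pi^2},1\right]$ $$\frac{|A|^2+|b|^2}{(\mathrm{tr}\,A)^2}\le\frac1{n-1+\delta}\quad\text{a.e. in }\mathbb R^n,$$ where $|A|$ is the Frobenius norm. Put $\gamma:=\frac{\mathrm{tr}\,A}{|A|^2+|b|^2}$, $\tilde A:=\gamma A$, $\tilde b:=\gamma b$. Let $H^1_{\mathrm{per},0}(Y;\mathbb R^n)$ denote the space of $Y$-periodic $H^1$ vector fields with zero mean over $Y$, and define on it $$B_2(v,w):=\int_Y(\nabla\cdot v)\,(\tilde A:Dw+\tilde b\cdot w)+\frac12\int_Y\left(Dv-(Dv)^{\mathrm T}\right):\left(Dw-(Dw)^{\mathrm T}\right).$$ Then there exist a unique $\tilde r\in L^2_{\mathrm{per}}(Y)$ with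 $\int_Y\tilde r=1$ and $$\int_Y\tilde r\,(\tilde A:D^2\varphi+\tilde b\cdot\nabla\varphi)=0\qquad\forall\varphi\in H^2_{\mathrm{per}}(Y),$$ and a unique $\rho\in H^1_{\mathrm{per},0}(Y;\mathbb R^n)$ with $B_2(\rho,w)=\int_Y(\tilde A:Dw+\tilde b\cdot w)$ for all $w\in H^1_{\mathrm{per},0}(Y;\mathbb R^n)$. Moreover, for every closed linear subspace $P_h$ of $H^1_{\mathrm{per},0}(Y;\mathbb R^n)$ there exists a unique $\rho_h\in P_h$ such that $$B_2(\rho_h,w_h)=\int_Y(\tilde A:Dw_h+\tilde b\cdot w_h)\qquad\forall w_h\in P_h,$$ and, setting $\tilde r_h:=1-\nabla\cdot\rho_h$, there holds $$\|\tilde r-\tilde r_h\|_{L^2(Y)}\le C\inf_{w_h\in P_h}\|D(\rho-w_h)\|_{L^2(Y;\mathbb R^{n\times n})},$$ where $$C:=\frac{1+\frac{\Lambda}{\lambda}\sqrt n\,\sqrt{1+\frac{n}{\pi^2}}}{1-\sqrt{1-\kappa}}>0,\qquad \kappa:=\left(\delta-\frac{n}{n+\pi^2}\right)\frac{n+\pi^2}{\pi^2},$$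 depends only on $\lambda,\Lambda,\delta,n$. -/

import Mathlib

open MeasureTheory
open scoped ENNReal ContDiff

noncomputable section

namespace FPK

/-- The open unit cell `Y = (0,1)^n`. -/
def cell (n : ℕ) : Set (Fin n → ℝ) := Set.univ.pi fun _ => Set.Ioo (0 : ℝ) 1

/-- Lebesgue measure on the unit cell. -/
abbrev cellMeasure (n : ℕ) : Measure (Fin n → ℝ) := volume.restrict (cell n)

/-- Invariance under integer translations (it suffices to ask it for the coordinate directions). -/
def IsCellPeriodic {n : ℕ} {β : Type*} (f : (Fin n → ℝ) → β) : Prop :=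
  ∀ (i : Fin n) (x : Fin n → ℝ), f (x + Pi.single i 1) = f x

/-- The almost everywhere version, which is the one that makes sense for classes of functions. -/
def IsAECellPeriodic {n : ℕ} {β : Type*} (f : (Fin n → ℝ) → β) : Prop :=
  ∀ i : Fin n, ∀ᵐ x : Fin n → ℝ, f (x + Pi.single i 1) = f x

/-- The classical partial derivative `∂φ/∂x_j`. -/
def partialDeriv {n : ℕ} (j : Fin n) (φ : (Fin n → ℝ) → ℝ) (x : Fin n → ℝ) : ℝ :=
  fderiv ℝ φ x (Pi.single j 1)

/-- `L²_per(Y)`: a `Y`-periodic locally square-integrable function on `ℝⁿ` is the same thing as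
its restriction to the unit cell. -/
abbrev L2per (n : ℕ) : Type := Lp ℝ 2 (cellMeasure n)

/-- `g` is the weak partial derivative `∂_j u` of the periodic function `u`: integration by parts
over one period holds against every smooth `Y`-periodic test function.  (Since the test functions
need not vanish on the boundary of the cell, this is the derivative on the torus, that is, the weak
derivative on `ℝⁿ` of the periodic extension of `u`.) -/
def IsWeakPartial {n : ℕ} (j : Fin n) (u g : L2per n) : Prop :=
  ∀ φ : (Fin n → ℝ) → ℝ, ContDiff ℝ ∞ φ → IsCellPeriodic φ →
    ∫ x in cell n, u x * partialDeriv j φ x = - ∫ x in cell n, g x * φ x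

theorem cell_subset_Icc (n : ℕ) : cell n ⊆ Set.Icc (0 : Fin n → ℝ) 1 := fun _ hx =>
  ⟨fun i => (hx i (Set.mem_univ i)).1.le, fun i => (hx i (Set.mem_univ i)).2.le⟩

theorem measurableSet_cell (n : ℕ) : MeasurableSet (cell n) :=
  MeasurableSet.univ_pi fun _ => measurableSet_Ioo

instance isFiniteMeasure_cellMeasure (n : ℕ) : IsFiniteMeasure (cellMeasure n) :=
  isFiniteMeasure_restrict.2
    (((isCompact_Icc (a := (0 : Fin n → ℝ)) (b := 1)).measure_lt_top.trans_le'
      (measure_mono (cell_subset_Icc n))).ne)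

theorem memLp_of_continuous {n : ℕ} {f : (Fin n → ℝ) → ℝ} (hf : Continuous f) :
    MemLp f 2 (cellMeasure n) := by
  obtain ⟨C, hC⟩ := (isCompact_Icc (a := (0 : Fin n → ℝ)) (b := 1)).exists_bound_of_continuousOn
    hf.continuousOn
  refine MemLp.of_bound hf.aestronglyMeasurable C ?_
  filter_upwards [ae_restrict_mem (measurableSet_cell n)] with x hx
  exact hC x (cell_subset_Icc n hx)

theorem integrable_mul_of_continuous {n : ℕ} (u : L2per n) {f : (Fin n → ℝ) → ℝ}
    (hf : Continuous f) : Integrable (fun x => u x * f x) (cellMeasure n) :=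
  (Lp.memLp u).integrable_mul (memLp_of_continuous hf)

theorem continuous_partialDeriv {n : ℕ} (j : Fin n) {φ : (Fin n → ℝ) → ℝ}
    (hφ : ContDiff ℝ ∞ φ) : Continuous (partialDeriv j φ) :=
  (hφ.continuous_fderiv (by simp)).clm_apply continuous_const

theorem integral_add_mul {n : ℕ} (u v : L2per n) {f : (Fin n → ℝ) → ℝ} (hf : Continuous f) :
    ∫ x in cell n, (u + v : L2per n) x * f x
      = (∫ x in cell n, u x * f x) + ∫ x in cell n, v x * f x := by
  rw [← integral_add (integrable_mul_of_continuous u hf) (integrable_mul_of_continuous v hf)]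
  refine integral_congr_ae ?_
  filter_upwards [Lp.coeFn_add u v] with x hx
  rw [hx, Pi.add_apply, add_mul]

theorem integral_smul_mul {n : ℕ} (c : ℝ) (u : L2per n) (f : (Fin n → ℝ) → ℝ) :
    ∫ x in cell n, (c • u : L2per n) x * f x = c * ∫ x in cell n, u x * f x := by
  rw [← integral_const_mul]
  refine integral_congr_ae ?_
  filter_upwards [Lp.coeFn_smul c u] with x hx
  rw [hx, Pi.smul_apply, smul_eq_mul, mul_assoc]

theorem integral_zero_mul {n : ℕ} (f : (Fin n → ℝ) → ℝ) :
    ∫ x in cell n, (0 : L2per n) x * f x = 0 := by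
  have h := integral_smul_mul (0 : ℝ) (0 : L2per n) f
  rwa [zero_smul, zero_mul] at h

theorem IsWeakPartial.zero {n : ℕ} (j : Fin n) : IsWeakPartial j (0 : L2per n) 0 :=
  fun φ _ _ => by rw [integral_zero_mul, integral_zero_mul, neg_zero]

theorem IsWeakPartial.add {n : ℕ} {j : Fin n} {u v g h : L2per n} (hu : IsWeakPartial j u g)
    (hv : IsWeakPartial j v h) : IsWeakPartial j (u + v) (g + h) := fun φ hφ hp => by
  rw [integral_add_mul u v (continuous_partialDeriv j hφ), integral_add_mul g h hφ.continuous,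
    hu φ hφ hp, hv φ hφ hp, neg_add]

theorem IsWeakPartial.smul {n : ℕ} {j : Fin n} {u g : L2per n} (c : ℝ)
    (hu : IsWeakPartial j u g) : IsWeakPartial j (c • u) (c • g) := fun φ hφ hp => by
  rw [integral_smul_mul, integral_smul_mul, hu φ hφ hp, mul_neg]

/-- The Hilbert space `L²_per(Y;ℝⁿ) × L²_per(Y;ℝ^{n×n})` with the norm
`(‖w‖_{L²}² + ‖G‖_{L²}²)^{1/2}`; vectors carry the Euclidean and matrices the Frobenius norm. -/
abbrev L2Pair (n : ℕ) : Type :=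
  WithLp 2 (PiLp 2 (fun _ : Fin n => L2per n) × PiLp 2 (fun _ : Fin n × Fin n => L2per n))

/-- `H¹_{per,0}(Y;ℝⁿ)`: the periodic vector fields `w` of class `H¹` with zero mean over `Y`, each
of them recorded together with its weak Jacobian, `(Dw)_{ij} = ∂_j w_i`, which it determines.  As a
subspace of `L2Pair n` the space carries the `H¹` norm `(‖w‖_{L²}² + ‖Dw‖_{L²}²)^{1/2}`. -/
def H1perZero (n : ℕ) : Submodule ℝ (L2Pair n) where
  carrier := {p | (∀ i, ∫ x in cell n, p.fst i x = 0) ∧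
    ∀ i j, IsWeakPartial j (p.fst i) (p.snd (i, j))}
  zero_mem' := by
    refine ⟨fun i => ?_, fun i j => IsWeakPartial.zero j⟩
    simpa using integral_zero_mul (n := n) (fun _ => 1)
  add_mem' := by
    rintro p q ⟨hp, hp'⟩ ⟨hq, hq'⟩
    refine ⟨fun i => ?_, fun i j => (hp' i j).add (hq' i j)⟩
    have h := integral_add_mul (p.fst i) (q.fst i) (continuous_const (y := (1 : ℝ)))
    simp only [mul_one] at h
    simpa [hp i, hq i] using h
  smul_mem' := by
    rintro c p ⟨hp, hp'⟩
    refine ⟨fun i => ?_, fun i j => (hp' i j).smul c⟩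
    have h := integral_smul_mul c (p.fst i) (fun _ => 1)
    simp only [mul_one] at h
    simpa [hp i] using h

/-- The component `w_i`. -/
def comp {n : ℕ} (w : H1perZero n) (i : Fin n) : L2per n := (w : L2Pair n).fst i

/-- The weak Jacobian `Dw`, in `L²_per(Y;ℝ^{n×n})`; its norm is
`‖Dw‖_{L²} = (∑_{ij} ‖∂_j w_i‖_{L²}²)^{1/2}`. -/
def jac {n : ℕ} (w : H1perZero n) : PiLp 2 (fun _ : Fin n × Fin n => L2per n) :=
  (w : L2Pair n).snd

/-- The divergence `∇·w`. -/
def divg {n : ℕ} (w : H1perZero n) : L2per n := ∑ i, jac w (i, i)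

/-- `φ` belongs to `H²_per(Y)`, with weak gradient `g` and weak Hessian `H`. -/
def IsH2per {n : ℕ} (φ : L2per n) (g : Fin n → L2per n) (H : Fin n → Fin n → L2per n) : Prop :=
  (∀ i, IsWeakPartial i φ (g i)) ∧ ∀ i j, IsWeakPartial j (g i) (H i j)

/-- The squared Frobenius norm `|M|² = M : M`. -/
def frobSq {n : ℕ} (M : Matrix (Fin n) (Fin n) ℝ) : ℝ := ∑ i, ∑ j, M i j ^ 2

/-- The squared Euclidean norm `|v|²`. -/
def euclSq {n : ℕ} (v : Fin n → ℝ) : ℝ := ∑ i, v i ^ 2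

/-- The standing assumptions on the coefficients: `A` and `b` are essentially bounded and
`Y`-periodic, `A` is symmetric with `lam I ≤ A ≤ Lam I`, and the Cordes-type condition holds with
the parameter `δ`.  (`Matrix.PosSemidef` includes symmetry.) -/
structure IsCordes {n : ℕ} (A : (Fin n → ℝ) → Matrix (Fin n) (Fin n) ℝ)
    (b : (Fin n → ℝ) → Fin n → ℝ) (lam Lam δ : ℝ) : Prop where
  memLp_A : ∀ i j, MemLp (fun x => A x i j) ∞ volume
  memLp_b : ∀ i, MemLp (fun x => b x i) ∞ volume
  periodic_A : IsAECellPeriodic A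
  periodic_b : IsAECellPeriodic b
  lam_pos : 0 < lam
  Lam_pos : 0 < Lam
  elliptic : ∀ᵐ x : Fin n → ℝ, (A x - lam • (1 : Matrix (Fin n) (Fin n) ℝ)).PosSemidef ∧
    (Lam • (1 : Matrix (Fin n) (Fin n) ℝ) - A x).PosSemidef
  lt_delta : (n : ℝ) / (n + Real.pi ^ 2) < δ
  delta_le : δ ≤ 1
  cordes : ∀ᵐ x : Fin n → ℝ,
    (frobSq (A x) + euclSq (b x)) / (A x).trace ^ 2 ≤ 1 / ((n : ℝ) - 1 + δ)

section Coefficients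

variable {n : ℕ} (A : (Fin n → ℝ) → Matrix (Fin n) (Fin n) ℝ) (b : (Fin n → ℝ) → Fin n → ℝ)

/-- The renormalization function `γ = tr(A) / (|A|² + |b|²)`. -/
def renorm (x : Fin n → ℝ) : ℝ := (A x).trace / (frobSq (A x) + euclSq (b x))

/-- The renormalized diffusion `Ã = γ A`. -/
def Atil (x : Fin n → ℝ) : Matrix (Fin n) (Fin n) ℝ := renorm A b x • A x

/-- The renormalized drift `b̃ = γ b`. -/
def btil (x : Fin n → ℝ) : Fin n → ℝ := renorm A b x • b x

/-- The function `Ã : M + b̃ · v`, for a matrix field `M` and a vector field `v`. -/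
def ndOp (M : Fin n → Fin n → L2per n) (v : Fin n → L2per n) (x : Fin n → ℝ) : ℝ :=
  (∑ i, ∑ j, Atil A b x i j * M i j x) + ∑ i, btil A b x i * v i x

/-- The bilinear form
`B₂(v,w) = ∫_Y (∇·v)(Ã:Dw + b̃·w) + ½ ∫_Y (Dv - (Dv)ᵀ) : (Dw - (Dw)ᵀ)`. -/
def B2 (v w : H1perZero n) : ℝ :=
  (∫ x in cell n, divg v x * ndOp A b (fun i j => jac w (i, j)) (comp w) x)
    + 1 / 2 * ∫ x in cell n, ∑ i, ∑ j,
        (jac v (i, j) x - jac v (j, i) x) * (jac w (i, j) x - jac w (j, i) x)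

/-- The linear functional `w ↦ ∫_Y (Ã:Dw + b̃·w)`. -/
def loadFun (w : H1perZero n) : ℝ :=
  ∫ x in cell n, ndOp A b (fun i j => jac w (i, j)) (comp w) x

/-- `ρ` solves the Galerkin problem in the subspace `P`: `ρ ∈ P` and
`B₂(ρ,w) = ∫_Y (Ã:Dw + b̃·w)` for all `w ∈ P`. -/
def IsGalerkinSol (P : Submodule ℝ (H1perZero n)) (ρ : H1perZero n) : Prop :=
  ρ ∈ P ∧ ∀ w ∈ P, B2 A b ρ w = loadFun A b w

/-- `r` is a (very weak) `L²_per(Y)` solution of `-D²:(Ã r) + ∇·(b̃ r) = 0` in `Y`, with `r`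
`Y`-periodic and `∫_Y r = 1`: the equation is tested with all `φ ∈ H²_per(Y)`. -/
def IsRenormFPKSol (r : L2per n) : Prop :=
  (∀ (φ : L2per n) (g : Fin n → L2per n) (H : Fin n → Fin n → L2per n), IsH2per φ g H →
    ∫ x in cell n, r x * ndOp A b H g x = 0) ∧
  ∫ x in cell n, r x = 1

end Coefficients

/-- `κ(δ,n) = (δ - n/(n+π²)) (n+π²)/π²`. -/
def kappa (δ : ℝ) (n : ℕ) : ℝ :=
  (δ - (n : ℝ) / (n + Real.pi ^ 2)) * ((n + Real.pi ^ 2) / Real.pi ^ 2)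

/-- The constant in the error bound; it depends only on `λ`, `Λ`, `δ` and `n`. -/
def errConst (lam Lam δ : ℝ) (n : ℕ) : ℝ :=
  (1 + Lam / lam * √(n : ℝ) * √(1 + (n : ℝ) / Real.pi ^ 2)) / (1 - √(1 - kappa δ n))

end FPK

end

/-! Write `L w = Ã : Dw + b̃ · w`. The normalization `γ` makes `|Ã - I|² + |b̃|²` equal to `n - (tr
A)² / (|A|² + |b|²)`, and the Cordes condition bounds this by `1 - δ`. Hence `L w` differs from
`∇·w` in `L²` by at most `√(1 - δ)` times the `H¹` norm of `w`. The Poincaré inequality in the form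
`‖w‖² ≤ (1 + n/π²) ‖Dw‖²` turns this into `√(1 - κ) ‖Dw‖` (`norm_ndL_sub_divg_le`), and the lower
bound on `δ` says exactly that `κ > 0`.

For periodic fields `‖Dw‖² = ‖∇·w‖² + ½ ‖Dw - (Dw)ᵀ‖²` (`norm_jac_sq`), so `B₂(w,w)` is `‖Dw‖²` up
to a perturbation of relative size `√(1 - κ) < 1`. This gives coercivity (`le_formL_self`), and
Lax–Milgram solves the problem for `ρ` and its restriction to any closed subspace.

Gradients have no skew part, so testing the equation for `ρ` with `∇φ` shows that `1 - ∇·ρ` solves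
the Fokker–Planck problem. It is the only solution: the difference of two solutions has mean zero,
hence is some `Δφ`, and then `B₂(∇φ,∇φ) = 0` (`isRenormFPKSol_unique`). The error `r̃ - r̃_h` is
therefore `-∇·(ρ - ρ_h)`, which Céa's lemma controls.

The analytic inputs, namely Poincaré, the exchange of derivatives under the integral and the `H²`
solution of Poisson's equation, are read off from Fourier coefficients, on which weak derivatives
act as multiplication by `2πi k_j`. -/

noncomputable section

namespace FPK

open UnitAddTorus ComplexConjugate

/-! ### Passage from the cell to the torus, and Fourier coefficients. -/

/-- The normalized Haar measure of the torus `(ℝ/ℤ)ⁿ`. -/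
abbrev torusMeasure (n : ℕ) : Measure (UnitAddTorus (Fin n)) :=
  Measure.pi fun _ => AddCircle.haarAddCircle

/-- The projection of `ℝⁿ` onto the torus. -/
def toTorus {n : ℕ} (x : Fin n → ℝ) : UnitAddTorus (Fin n) := fun i => (x i : UnitAddCircle)

/-- The section of `toTorus` with values in `(0,1]ⁿ`. -/
def ofTorus {n : ℕ} (t : UnitAddTorus (Fin n)) : Fin n → ℝ :=
  fun i => (AddCircle.equivIoc (1 : ℝ) 0 (t i)).1

theorem toTorus_ofTorus {n : ℕ} (t : UnitAddTorus (Fin n)) : toTorus (ofTorus t) = t :=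
  funext fun _ => AddCircle.coe_equivIoc

theorem continuous_toTorus {n : ℕ} : Continuous (toTorus (n := n)) :=
  continuous_pi fun i => (AddCircle.continuous_mk' 1).comp (continuous_apply i)

theorem measurePreserving_ofTorus (n : ℕ) :
    MeasurePreserving (ofTorus (n := n)) (torusMeasure n) (cellMeasure n) := by
  have hs : MeasurableSet {x : Fin n → ℝ | ∀ i, x i ∈ Set.Ioc (0 : ℝ) (0 + 1)} :=
    MeasurableSet.univ_pi' fun _ => measurableSet_Ioc
  have h := (measurePreserving_subtype_coe (μa := (volume : Measure (Fin n → ℝ))) hs).comp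
    (measurePreserving_equivPiIoc (0 : Fin n → ℝ))
  have e : (volume : Measure (Fin n → ℝ)).restrict
      {x : Fin n → ℝ | ∀ i, x i ∈ Set.Ioc (0 : ℝ) (0 + 1)} = cellMeasure n := by
    have h1 : {x : Fin n → ℝ | ∀ i, x i ∈ Set.Ioc (0 : ℝ) (0 + 1)}
        = Set.univ.pi fun _ => Set.Ioc (0 : ℝ) 1 := by ext; simp
    rw [h1]
    -- The half-open and the open cube both agree almost everywhere with the closed one.
    exact Measure.restrict_congr_set ((Measure.univ_pi_Ioc_ae_eq_Icc
      (f := fun _ : Fin n => (0 : ℝ)) (g := fun _ => 1)).trans Measure.univ_pi_Ioo_ae_eq_Icc.symm)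
  rw [← e]
  exact h

theorem measurePreserving_toTorus (n : ℕ) :
    MeasurePreserving (toTorus (n := n)) (cellMeasure n) (torusMeasure n) := by
  refine ⟨continuous_toTorus.measurable, ?_⟩
  rw [← (measurePreserving_ofTorus n).map_eq,
    Measure.map_map continuous_toTorus.measurable (measurePreserving_ofTorus n).measurable]
  have : toTorus ∘ ofTorus (n := n) = id := funext toTorus_ofTorus
  rw [this, Measure.map_id]

/-- A real function on the cell, viewed as a complex function on the torus. -/
def torusL (n : ℕ) : L2per n →L[ℝ] Lp ℂ 2 (torusMeasure n) :=
  (Complex.ofRealCLM.compLpL 2 (torusMeasure n)).comp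
    (Lp.compMeasurePreservingₗᵢ ℝ ofTorus (measurePreserving_ofTorus n)).toContinuousLinearMap

theorem torusL_coeFn {n : ℕ} (u : L2per n) :
    torusL n u =ᵐ[torusMeasure n] fun t => ((u (ofTorus t) : ℝ) : ℂ) := by
  refine (Complex.ofRealCLM.coeFn_compLpL _).trans ?_
  filter_upwards [Lp.coeFn_compMeasurePreserving u (measurePreserving_ofTorus n)] with t ht
  exact congrArg Complex.ofReal ht

theorem inner_L2 {n : ℕ} (u v : L2per n) : inner ℝ u v = ∫ x in cell n, u x * v x := by
  rw [L2.inner_def]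
  simp [mul_comm]

theorem inner_torusL {n : ℕ} (u v : L2per n) :
    inner ℂ (torusL n u) (torusL n v) = ((inner ℝ u v : ℝ) : ℂ) := by
  have h := (Lp.compMeasurePreservingₗᵢ ℝ ofTorus (measurePreserving_ofTorus n)
    (E := ℝ) (p := 2)).inner_map_map u v
  rw [← h, L2.inner_def, L2.inner_def, ← integral_complex_ofReal]
  refine integral_congr_ae ?_
  filter_upwards [Complex.ofRealCLM.coeFn_compLpL (Lp.compMeasurePreservingₗᵢ ℝ ofTorus
    (measurePreserving_ofTorus n) u), Complex.ofRealCLM.coeFn_compLpL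
    (Lp.compMeasurePreservingₗᵢ ℝ ofTorus (measurePreserving_ofTorus n) v)] with t h1 h2
  simp only [torusL, ContinuousLinearMap.comp_apply]
  erw [h1, h2]
  simp

/-- The Fourier coefficients of `u`. -/
def coef {n : ℕ} (u : L2per n) (k : Fin n → ℤ) : ℂ := mFourierBasis.repr (torusL n u) k

theorem coef_add {n : ℕ} (u v : L2per n) (k : Fin n → ℤ) :
    coef (u + v) k = coef u k + coef v k := by
  simp only [coef, map_add]; rfl

theorem coef_sum {n : ℕ} {ι : Type*} (s : Finset ι) (u : ι → L2per n) (k : Fin n → ℤ) :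
    coef (∑ i ∈ s, u i) k = ∑ i ∈ s, coef (u i) k :=
  map_sum (⟨⟨fun u => coef u k, by simp only [coef, map_zero]; rfl⟩,
    fun u v => coef_add u v k⟩ : L2per n →+ ℂ) u s

theorem coef_sub {n : ℕ} (u v : L2per n) (k : Fin n → ℤ) :
    coef (u - v) k = coef u k - coef v k := by
  simp only [coef, map_sub]; rfl

/-- Parseval's identity. -/
theorem hasSum_coef {n : ℕ} (u v : L2per n) :
    HasSum (fun k => conj (coef u k) * coef v k) ((inner ℝ u v : ℝ) : ℂ) := by
  rw [← inner_torusL]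
  convert! mFourierBasis.hasSum_inner_mul_inner (torusL n u) (torusL n v) using 2 with k
  simp only [coef, HilbertBasis.repr_apply_apply, inner_conj_symm]

theorem hasSum_norm_coef {n : ℕ} (u : L2per n) :
    HasSum (fun k => ‖coef u k‖ ^ 2) (‖u‖ ^ 2) := by
  have h := Complex.hasSum_re (hasSum_coef u u)
  rw [Complex.ofReal_re, real_inner_self_eq_norm_sq] at h
  convert! h using 2 with k
  rw [← Complex.normSq_eq_conj_mul_self, Complex.ofReal_re, Complex.normSq_eq_norm_sq]

theorem coef_injective {n : ℕ} {u v : L2per n} (h : ∀ k, coef u k = coef v k) : u = v := by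
  have h1 := hasSum_norm_coef (u - v)
  have h2 : (fun k => ‖coef (u - v) k‖ ^ 2) = fun _ => 0 := by
    funext k; simp [coef_sub, h k]
  rw [h2] at h1
  have := h1.unique hasSum_zero
  rwa [sq_eq_zero_iff, norm_eq_zero, sub_eq_zero] at this

/-- The phase `2π k·x`. -/
def phase {n : ℕ} (k : Fin n → ℤ) (x : Fin n → ℝ) : ℝ := ∑ i, 2 * Real.pi * k i * x i

theorem mFourier_toTorus {n : ℕ} (k : Fin n → ℤ) (x : Fin n → ℝ) :
    mFourier k (toTorus x) = Real.cos (phase k x) + Real.sin (phase k x) * Complex.I := by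
  rw [Complex.ofReal_cos, Complex.ofReal_sin, ← Complex.exp_mul_I, phase]
  simp only [mFourier, toTorus, ContinuousMap.coe_mk, fourier_coe_apply]
  rw [← Complex.exp_sum]
  congr 1
  rw [Complex.ofReal_sum, Finset.sum_mul]
  exact Finset.sum_congr rfl fun i _ => by push_cast; ring

/-- Weak derivatives are tested with real functions only, so the coefficient is split into its
cosine and sine integrals. -/
theorem coef_eq_integral {n : ℕ} (u : L2per n) (k : Fin n → ℤ) :
    coef u k = ((∫ x in cell n, u x * Real.cos (phase k x) : ℝ) : ℂ)
      - Complex.I * (∫ x in cell n, u x * Real.sin (phase k x) : ℝ) := by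
  have hc : Continuous (phase k) := by unfold phase; fun_prop
  have h1 : coef u k = ∫ x in cell n, mFourier (-k) (toTorus x) * (u x : ℂ) := by
    have h2 : AEStronglyMeasurable (fun x => mFourier (-k) (toTorus x) * (u x : ℂ))
        (cellMeasure n) :=
      ((mFourier (-k)).continuous.comp continuous_toTorus).aestronglyMeasurable.mul
        (Complex.continuous_ofReal.comp_aestronglyMeasurable (Lp.aestronglyMeasurable u))
    have h3 := integral_map (measurePreserving_ofTorus n).measurable.aemeasurable
      (by rwa [(measurePreserving_ofTorus n).map_eq])
    rw [(measurePreserving_ofTorus n).map_eq] at h3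
    rw [h3, coef, mFourierBasis_repr, mFourierCoeff]
    refine integral_congr_ae ?_
    filter_upwards [torusL_coeFn u] with t ht
    simp only [toTorus_ofTorus, smul_eq_mul]
    erw [ht]
  rw [h1, ← integral_complex_ofReal, ← integral_complex_ofReal, ← integral_const_mul,
    ← integral_sub]
  · refine integral_congr_ae (Filter.Eventually.of_forall fun x => ?_)
    have : phase (-k) x = -phase k x := by simp [phase]
    simp only [mFourier_toTorus, this, Real.cos_neg, Real.sin_neg]
    push_cast; ring
  · exact (integrable_mul_of_continuous u (Real.continuous_cos.comp hc)).ofReal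
  · exact (integrable_mul_of_continuous u (Real.continuous_sin.comp hc)).ofReal.const_mul _

theorem coef_zero {n : ℕ} (u : L2per n) : coef u 0 = ((∫ x in cell n, u x : ℝ) : ℂ) := by
  rw [coef_eq_integral]; simp [phase]

theorem coef_neg {n : ℕ} (u : L2per n) (k : Fin n → ℤ) : coef u (-k) = conj (coef u k) := by
  have h (x : Fin n → ℝ) : phase (-k) x = -phase k x := by simp [phase]
  rw [coef_eq_integral, coef_eq_integral]
  simp [h, integral_neg]

/-- Every square-summable family with the Hermitian symmetry is the family of Fourier coefficients
of a real function. -/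
theorem exists_coef_eq {n : ℕ} (a : (Fin n → ℤ) → ℂ) (ha : Memℓp a 2)
    (hs : ∀ k, a (-k) = conj (a k)) : ∃ u : L2per n, ∀ k, coef u k = a k := by
  let Φ : Lp ℂ 2 (torusMeasure n) := mFourierBasis.repr.symm ⟨a, ha⟩
  have hΦ (k) : mFourierBasis.repr Φ k = a k := by
    simp only [Φ]; erw [LinearIsometryEquiv.apply_symm_apply]
  -- Hermitian symmetry of `a` means that the conjugate of `Φ` has the same coefficients as `Φ`, so
  -- that `Φ` is real.
  let Ψ : Lp ℂ 2 (torusMeasure n) := Complex.conjCLE.toContinuousLinearMap.compLp Φ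
  have hΨ : Ψ =ᵐ[torusMeasure n] fun t => conj (Φ t) :=
    Complex.conjCLE.toContinuousLinearMap.coeFn_compLp Φ
  have hΦΨ : Ψ = Φ := by
    apply mFourierBasis.repr.injective
    ext k
    rw [hΦ, ← Complex.conj_conj (a k), ← hs, ← hΦ, mFourierBasis_repr, mFourierBasis_repr,
      mFourierCoeff, mFourierCoeff, ← integral_conj]
    refine integral_congr_ae ?_
    filter_upwards [hΨ] with t ht
    simp only [smul_eq_mul, map_mul]
    erw [ht]
    rw [neg_neg, mFourier_neg]
  have hre : Φ =ᵐ[torusMeasure n] fun t => ((Φ t).re : ℂ) := by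
    rw [hΦΨ] at hΨ
    filter_upwards [hΨ] with t ht
    exact (Complex.conj_eq_iff_re.1 ht.symm).symm
  have hmem : MemLp (fun x => (Φ (toTorus x)).re) 2 (cellMeasure n) := by
    have : MemLp (fun x => Φ (toTorus x)) 2 (cellMeasure n) :=
      (Lp.memLp Φ).comp_measurePreserving (measurePreserving_toTorus n)
    exact this.re
  refine ⟨hmem.toLp, fun k => ?_⟩
  suffices h : torusL n hmem.toLp = Φ by rw [← hΦ k, coef, h]
  refine Lp.ext ?_
  have h2 := (measurePreserving_ofTorus n).quasiMeasurePreserving.ae_eq_comp hmem.coeFn_toLp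
  refine (torusL_coeFn _).trans (Filter.EventuallyEq.trans ?_ hre.symm)
  filter_upwards [h2] with t ht
  simp only [Function.comp_apply] at ht
  rw [ht, toTorus_ofTorus]

/-! ### Weak derivatives as Fourier multipliers. -/

/-- The integral of a partial derivative of a smooth periodic function over a period vanishes. -/
theorem integral_partialDeriv_eq_zero {n : ℕ} (j : Fin n) {f : (Fin n → ℝ) → ℝ}
    (hf : ContDiff ℝ ∞ f) (hp : IsCellPeriodic f) : ∫ x in cell n, partialDeriv j f x = 0 := by
  obtain ⟨m, rfl⟩ : ∃ m, n = m + 1 := ⟨n - 1, by have := j.pos; omega⟩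
  have hd : Differentiable ℝ f := hf.differentiable (by simp)
  have e : cell (m + 1) =ᵐ[volume] Set.Icc (0 : Fin (m + 1) → ℝ) 1 :=
    Measure.univ_pi_Ioo_ae_eq_Icc (f := fun _ : Fin (m + 1) => (0 : ℝ)) (g := fun _ => 1)
  -- The divergence theorem for the field `f e_j`; only the two faces orthogonal to `e_j`
  -- contribute.
  have h := integral_divergence_of_hasFDerivAt_off_countable' (0 : Fin (m + 1) → ℝ) 1
    (by intro i; simp) (fun i x => if i = j then f x else 0)
    (fun i x => if i = j then fderiv ℝ f x else 0) ∅ Set.countable_empty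
    (fun i => by split_ifs; exacts [hf.continuous.continuousOn, continuousOn_const])
    (fun x _ i => by split_ifs; exacts [(hd x).hasFDerivAt, hasFDerivAt_const _ _])
    (by
      refine Continuous.integrableOn_Icc (continuous_finsetSum _ fun i _ => ?_)
      split_ifs
      · exact (hf.continuous_fderiv (by simp)).clm_apply continuous_const
      · exact continuous_const)
  have h1 (x : Fin (m + 1) → ℝ) : (∑ i, (if i = j then fderiv ℝ f x else 0) (Pi.single i 1))
      = partialDeriv j f x := by
    rw [Finset.sum_eq_single j (fun i _ hi => by simp [hi]) (by simp)]
    simp [partialDeriv]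
  simp only [h1] at h
  rw [setIntegral_congr_set e, h]
  refine Finset.sum_eq_zero fun i _ => ?_
  by_cases hi : i = j
  · subst hi
    simp only [if_true]
    rw [sub_eq_zero]
    refine integral_congr_ae (Filter.Eventually.of_forall fun x => ?_)
    -- Periodicity identifies the values on the opposite faces `x_i = 0` and `x_i = 1`, whose
    -- contributions cancel.
    have := hp i (i.insertNth (0 : ℝ) x)
    simp only [Pi.one_apply, Pi.zero_apply]
    rw [← this]
    congr 1
    ext k
    refine Fin.succAboveCases i ?_ (fun k => ?_) k
    · simp
    · simp
  · simp [hi]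

theorem partialDeriv_mul {n : ℕ} (j : Fin n) {f g : (Fin n → ℝ) → ℝ} (hf : ContDiff ℝ ∞ f)
    (hg : ContDiff ℝ ∞ g) (x : Fin n → ℝ) :
    partialDeriv j (f * g) x = f x * partialDeriv j g x + partialDeriv j f x * g x := by
  rw [partialDeriv, fderiv_mul (hf.differentiable (by simp) x) (hg.differentiable (by simp) x)]
  simp [partialDeriv, mul_comm]

/-- The class in `L²_per(Y)` of a continuous function. -/
def ofContinuous {n : ℕ} {f : (Fin n → ℝ) → ℝ} (hf : Continuous f) : L2per n :=
  (memLp_of_continuous hf).toLp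

theorem integral_ofContinuous_mul {n : ℕ} {f : (Fin n → ℝ) → ℝ} (hf : Continuous f)
    (g : (Fin n → ℝ) → ℝ) :
    ∫ x in cell n, ofContinuous hf x * g x = ∫ x in cell n, f x * g x := by
  refine integral_congr_ae ?_
  filter_upwards [(memLp_of_continuous hf).coeFn_toLp] with x hx
  rw [ofContinuous, hx]

theorem inner_ofContinuous {n : ℕ} {f : (Fin n → ℝ) → ℝ} (hf : Continuous f) (u : L2per n) :
    inner ℝ u (ofContinuous hf) = ∫ x in cell n, u x * f x := by
  rw [real_inner_comm, inner_L2, integral_ofContinuous_mul]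
  simp only [mul_comm]

theorem isWeakPartial_ofContinuous {n : ℕ} (j : Fin n) {f : (Fin n → ℝ) → ℝ}
    (hf : ContDiff ℝ ∞ f) (hp : IsCellPeriodic f) :
    IsWeakPartial j (ofContinuous hf.continuous) (ofContinuous (continuous_partialDeriv j hf)) := by
  intro g hg hpg
  rw [integral_ofContinuous_mul, integral_ofContinuous_mul, eq_neg_iff_add_eq_zero, ← integral_add]
  · have := integral_partialDeriv_eq_zero j (f := f * g) (hf.mul hg)
      (fun i x => by simp only [Pi.mul_apply, hp i x, hpg i x])
    simpa only [partialDeriv_mul j hf hg] using this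
  · exact (memLp_of_continuous hf.continuous).integrable_mul
      (memLp_of_continuous (continuous_partialDeriv j hg))
  · exact (memLp_of_continuous (continuous_partialDeriv j hf)).integrable_mul
      (memLp_of_continuous hg.continuous)

theorem contDiff_phase {n : ℕ} (k : Fin n → ℤ) : ContDiff ℝ ∞ (phase k) := by
  unfold phase; fun_prop

theorem phase_add_single {n : ℕ} (k : Fin n → ℤ) (i : Fin n) (x : Fin n → ℝ) (t : ℝ) :
    phase k (x + Pi.single i t) = phase k x + 2 * Real.pi * k i * t := by
  simp [phase, mul_add, Finset.sum_add_distrib, Pi.single_apply]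

theorem fderiv_phase {n : ℕ} (k : Fin n → ℤ) (j : Fin n) (x : Fin n → ℝ) :
    fderiv ℝ (phase k) x (Pi.single j 1) = 2 * Real.pi * k j := by
  rw [((contDiff_phase k).differentiable (by simp) x).lineDeriv_eq_fderiv.symm]
  refine HasLineDerivAt.lineDeriv ?_
  have : (fun t : ℝ => phase k (x + t • Pi.single j 1))
      = fun t => phase k x + 2 * Real.pi * k j * t := by
    funext t
    rw [← phase_add_single, ← Pi.single_smul, smul_eq_mul, mul_one]
  rw [HasLineDerivAt, this]
  simpa using ((hasDerivAt_id (0 : ℝ)).const_mul (2 * Real.pi * k j)).const_add (phase k x)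

theorem isCellPeriodic_comp_phase {n : ℕ} (k : Fin n → ℤ) {f : ℝ → ℝ}
    (hf : Function.Periodic f (2 * Real.pi)) : IsCellPeriodic fun x => f (phase k x) := by
  intro i x
  have := hf.int_mul (k i) (phase k x)
  simp only [phase_add_single]
  rw [← this]
  congr 1; ring

/-- Since `k` is integral, `cos (2π k·x)` and `sin (2π k·x)` are periodic, hence admissible test
functions. -/
theorem IsWeakPartial.coef_eq {n : ℕ} {j : Fin n} {u g : L2per n} (h : IsWeakPartial j u g)
    (k : Fin n → ℤ) : coef g k = 2 * Real.pi * k j * Complex.I * coef u k := by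
  have hd (x) := (contDiff_phase k).differentiable (by simp) x
  have h1 := h _ (Real.contDiff_cos.comp (contDiff_phase k))
    (isCellPeriodic_comp_phase k Real.cos_periodic)
  have h2 := h _ (Real.contDiff_sin.comp (contDiff_phase k))
    (isCellPeriodic_comp_phase k Real.sin_periodic)
  have e1 (x) : u x * partialDeriv j (Real.cos ∘ phase k) x
      = -(2 * Real.pi * k j) * (u x * Real.sin (phase k x)) := by
    have := ((Real.hasDerivAt_cos (phase k x)).comp_hasFDerivAt x (hd x).hasFDerivAt).fderiv
    rw [partialDeriv, this]
    simp [fderiv_phase]; ring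
  have e2 (x) : u x * partialDeriv j (Real.sin ∘ phase k) x
      = 2 * Real.pi * k j * (u x * Real.cos (phase k x)) := by
    have := ((Real.hasDerivAt_sin (phase k x)).comp_hasFDerivAt x (hd x).hasFDerivAt).fderiv
    rw [partialDeriv, this]
    simp [fderiv_phase]; ring
  simp only [e1, e2, integral_const_mul, Function.comp_apply] at h1 h2
  rw [coef_eq_integral, coef_eq_integral, ← neg_eq_iff_eq_neg.2 h1, ← neg_eq_iff_eq_neg.2 h2]
  push_cast
  linear_combination (2 * Real.pi * k j * (∫ x in cell n, u x * Real.sin (phase k x) : ℝ) : ℂ)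
    * Complex.I_sq

/-- Weak partial derivatives are characterized by the Fourier coefficients. -/
theorem isWeakPartial_iff_coef {n : ℕ} {j : Fin n} {u g : L2per n} :
    IsWeakPartial j u g ↔ ∀ k, coef g k = 2 * Real.pi * k j * Complex.I * coef u k := by
  refine ⟨fun h => h.coef_eq, fun h φ hφ hp => ?_⟩
  -- By Parseval, integration by parts against `φ` amounts to the multiplier `2πi k_j` being skew
  -- under conjugation.
  have hw := (isWeakPartial_ofContinuous j hφ hp).coef_eq
  rw [← inner_ofContinuous hφ.continuous, ← inner_ofContinuous (continuous_partialDeriv j hφ)]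
  have h1 := hasSum_coef u (ofContinuous (continuous_partialDeriv j hφ))
  have h2 := (hasSum_coef g (ofContinuous hφ.continuous)).neg
  have e : (fun k => conj (coef u k) * coef (ofContinuous (continuous_partialDeriv j hφ)) k)
      = fun k => -(conj (coef g k) * coef (ofContinuous hφ.continuous) k) := by
    funext k
    rw [hw, h]
    simp only [map_mul, Complex.conj_I, Complex.conj_ofReal, map_ofNat, map_intCast]
    ring
  rw [e] at h1
  exact_mod_cast h1.unique h2

/-- Mixed second derivatives may be exchanged under the integral sign. -/
theorem inner_weakPartial_comm {n : ℕ} {i j : Fin n} {u v ui uj vi vj : L2per n}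
    (hui : IsWeakPartial i u ui) (huj : IsWeakPartial j u uj) (hvi : IsWeakPartial i v vi)
    (hvj : IsWeakPartial j v vj) : (inner ℝ ui vj : ℝ) = inner ℝ uj vi := by
  have h1 := hasSum_coef ui vj
  have h2 := hasSum_coef uj vi
  have e : (fun k => conj (coef ui k) * coef vj k) = fun k => conj (coef uj k) * coef vi k := by
    funext k
    rw [hui.coef_eq, huj.coef_eq, hvi.coef_eq, hvj.coef_eq]
    simp only [map_mul, Complex.conj_I, Complex.conj_ofReal, map_ofNat, map_intCast]
    ring
  rw [e] at h1
  exact_mod_cast h1.unique h2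

/-- Weak Hessians are symmetric. -/
theorem IsH2per.symm {n : ℕ} {φ : L2per n} {g : Fin n → L2per n} {H : Fin n → Fin n → L2per n}
    (h : IsH2per φ g H) (i j : Fin n) : H i j = H j i :=
  coef_injective fun k => by
    rw [(h.2 i j).coef_eq, (h.2 j i).coef_eq, (h.1 i).coef_eq, (h.1 j).coef_eq]; ring

theorem IsWeakPartial.integral_eq_zero {n : ℕ} {j : Fin n} {u g : L2per n}
    (h : IsWeakPartial j u g) : ∫ x in cell n, g x = 0 := by
  have := h.coef_eq 0
  rw [coef_zero g] at this
  simpa using this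

/-! ### The Poincaré inequality and Poisson's equation on the torus. -/

theorem one_le_sum_sq {n : ℕ} {k : Fin n → ℤ} (hk : k ≠ 0) : (1 : ℝ) ≤ ∑ j, (k j : ℝ) ^ 2 := by
  obtain ⟨i, hi⟩ := Function.ne_iff.1 hk
  have h1 : (1 : ℤ) ≤ k i ^ 2 := Int.add_one_le_iff.2 (pow_two_pos_of_ne_zero hi)
  have h2 : (1 : ℝ) ≤ (k i : ℝ) ^ 2 := by exact_mod_cast h1
  exact h2.trans (Finset.single_le_sum (f := fun j => (k j : ℝ) ^ 2) (fun _ _ => sq_nonneg _)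
    (Finset.mem_univ i))

theorem norm_sq_two_pi_mul {n : ℕ} (k : Fin n → ℤ) (j : Fin n) (z : ℂ) :
    ‖2 * Real.pi * k j * Complex.I * z‖ ^ 2 = 4 * Real.pi ^ 2 * (k j : ℝ) ^ 2 * ‖z‖ ^ 2 := by
  simp only [norm_mul, Complex.norm_I, Complex.norm_real, Complex.norm_intCast, mul_pow,
    Complex.norm_ofNat, Real.norm_eq_abs, sq_abs]
  ring

/-- The Poincaré inequality on the torus. -/
theorem poincare {n : ℕ} {u : L2per n} {g : Fin n → L2per n} (hg : ∀ j, IsWeakPartial j u (g j))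
    (hu : ∫ x in cell n, u x = 0) : 4 * Real.pi ^ 2 * ‖u‖ ^ 2 ≤ ∑ j, ‖g j‖ ^ 2 := by
  have h1 := (hasSum_norm_coef u).mul_left (4 * Real.pi ^ 2)
  have h2 := hasSum_sum fun j (_ : j ∈ Finset.univ) => hasSum_norm_coef (g j)
  refine hasSum_le (fun k => ?_) h1 h2
  simp only [fun j => (hg j).coef_eq k, norm_sq_two_pi_mul, ← Finset.sum_mul, ← Finset.mul_sum]
  -- The zero mode is the mean, which vanishes; every other frequency has `|k|² ≥ 1`.
  by_cases hk : k = 0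
  · subst hk
    simp [coef_zero, hu]
  · have := one_le_sum_sq hk
    have h3 : 4 * Real.pi ^ 2 * 1 ≤ 4 * Real.pi ^ 2 * ∑ j, (k j : ℝ) ^ 2 := by gcongr
    rw [mul_one] at h3
    gcongr

/-- Poisson's equation `Δφ = s` has an `H²` solution on the torus if `s` has mean zero. -/
theorem exists_laplacian_eq {n : ℕ} (s : L2per n) (hs : ∫ x in cell n, s x = 0) :
    ∃ (φ : L2per n) (g : Fin n → L2per n) (H : Fin n → Fin n → L2per n), IsH2per φ g H ∧
      ∑ i, H i i = s := by
  have hsum : Summable fun k => ‖coef s k‖ ^ 2 := (hasSum_norm_coef s).summable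
  -- Bounded Hermitian multipliers act on `s`. The bound may fail at `k = 0`, where `coef s`
  -- vanishes.
  have key (m : (Fin n → ℤ) → ℂ) (C : ℝ) (hm : ∀ k ≠ 0, ‖m k‖ ≤ C)
      (hneg : ∀ k, m (-k) = conj (m k)) :
      ∃ u : L2per n, ∀ k, coef u k = m k * coef s k := by
    refine exists_coef_eq (fun k => m k * coef s k) ?_ (fun k => by rw [hneg, coef_neg, map_mul])
    refine memℓp_gen ?_
    refine Summable.of_nonneg_of_le (fun k => by positivity) (fun k => ?_) (hsum.mul_left (C ^ 2))
    simp only [ENNReal.toReal_ofNat, Real.rpow_ofNat, norm_mul, mul_pow]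
    by_cases hk : k = 0
    · subst hk
      simp [coef_zero, hs]
    · have := hm k hk
      gcongr
  let S (k : Fin n → ℤ) : ℝ := ∑ j, (k j : ℝ) ^ 2
  have hS (k : Fin n → ℤ) : S (-k) = S k := by simp [S]
  have hS1 (k : Fin n → ℤ) (hk : k ≠ 0) : 1 ≤ S k := one_le_sum_sq hk
  have hkS (k : Fin n → ℤ) (j : Fin n) : (k j : ℝ) ^ 2 ≤ S k :=
    Finset.single_le_sum (f := fun j => (k j : ℝ) ^ 2) (fun _ _ => sq_nonneg _)
      (Finset.mem_univ j)
  have hkS' (k : Fin n → ℤ) (hk : k ≠ 0) (j : Fin n) : |(k j : ℝ)| ≤ S k := by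
    have h1 := hkS k j
    have h2 := hS1 k hk
    rw [← sq_abs] at h1
    nlinarith [abs_nonneg (k j : ℝ)]
  -- The inverse symbol `-1/(4π²|k|²)` of the Laplacian. At `k = 0` it is the default value `0`.
  let m0 (k : Fin n → ℤ) : ℂ := ((-(4 * Real.pi ^ 2)⁻¹ * (S k)⁻¹ : ℝ) : ℂ)
  obtain ⟨φ, hφ⟩ := key m0 ((4 * Real.pi ^ 2)⁻¹)
    (fun k hk => by
      have := hS1 k hk
      simp only [m0, Complex.norm_real, norm_mul, norm_neg, norm_inv, Real.norm_eq_abs]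
      rw [abs_of_nonneg (by positivity : (0 : ℝ) ≤ 4), abs_of_nonneg (by positivity : 0 ≤ S k),
        abs_of_nonneg (by positivity : 0 ≤ Real.pi ^ 2)]
      exact mul_le_of_le_one_right (by positivity) (inv_le_one_of_one_le₀ this))
    (fun k => by simp only [m0, hS, Complex.conj_ofReal])
  have hg (i : Fin n) := key (fun k => 2 * Real.pi * k i * Complex.I * m0 k)
    ((2 * Real.pi)⁻¹)
    (fun k hk => by
      have h1 := hS1 k hk
      have h2 := hkS' k hk i
      have h3 : ‖2 * (Real.pi : ℂ) * k i * Complex.I * m0 k‖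
          = (2 * Real.pi)⁻¹ * (|(k i : ℝ)| * (S k)⁻¹) := by
        simp only [m0, Complex.norm_real, norm_mul, norm_neg, norm_inv, Real.norm_eq_abs,
          Complex.norm_I, Complex.norm_intCast, Complex.norm_ofNat, norm_pow,
          abs_of_nonneg (by positivity : (0 : ℝ) ≤ 4), abs_of_nonneg (by positivity : 0 ≤ S k),
          abs_of_nonneg Real.pi_pos.le]
        field_simp; norm_num; ring
      rw [h3]
      exact mul_le_of_le_one_right (by positivity)
        (by rw [← div_eq_mul_inv]; exact div_le_one_of_le₀ h2 (by positivity)))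
    (fun k => by
      simp only [m0, hS, Complex.conj_ofReal, map_mul, map_ofNat, map_intCast, Complex.conj_I,
        Pi.neg_apply]
      push_cast; ring)
  choose g hg using hg
  have hH (i j : Fin n) := key
    (fun k => 2 * Real.pi * k j * Complex.I * (2 * Real.pi * k i * Complex.I * m0 k)) 1
    (fun k hk => by
      have h1 := hS1 k hk
      have h2 : |(k j : ℝ)| * |(k i : ℝ)| ≤ S k := by
        nlinarith [hkS k j, hkS k i, sq_abs (k j : ℝ), sq_abs (k i : ℝ),
          sq_nonneg (|(k j : ℝ)| - |(k i : ℝ)|)]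
      have h3 : ‖2 * (Real.pi : ℂ) * k j * Complex.I *
          (2 * (Real.pi : ℂ) * k i * Complex.I * m0 k)‖
          = (|(k j : ℝ)| * |(k i : ℝ)|) * (S k)⁻¹ := by
        simp only [m0, Complex.norm_real, norm_mul, norm_neg, norm_inv, Real.norm_eq_abs,
          Complex.norm_I, Complex.norm_intCast, Complex.norm_ofNat, norm_pow,
          abs_of_nonneg (by positivity : (0 : ℝ) ≤ 4), abs_of_nonneg (by positivity : 0 ≤ S k),
          abs_of_nonneg Real.pi_pos.le]
        field_simp; norm_num; ring
      rw [h3, ← div_eq_mul_inv]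
      exact div_le_one_of_le₀ h2 (by positivity))
    (fun k => by
      simp only [m0, hS, Complex.conj_ofReal, map_mul, map_ofNat, map_intCast, Complex.conj_I,
        Pi.neg_apply]
      push_cast; ring)
  choose H hH using hH
  refine ⟨φ, g, H, ⟨fun i => isWeakPartial_iff_coef.2 fun k => ?_,
    fun i j => isWeakPartial_iff_coef.2 fun k => ?_⟩, coef_injective fun k => ?_⟩
  · rw [hg, hφ]; ring
  · rw [hH, hg]; ring
  · rw [coef_sum]
    by_cases hk : k = 0
    · subst hk
      simp [hH, coef_zero, hs]
    · have h1 : S k ≠ 0 := by have := hS1 k hk; positivity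
      have h2 (i : Fin n) : coef (H i i) k
          = (((k i : ℝ) ^ 2 * ((S k)⁻¹ : ℝ) : ℝ) : ℂ) * coef s k := by
        have hpi : (Real.pi : ℂ) ≠ 0 := by exact_mod_cast Real.pi_ne_zero
        have h1' : ((S k : ℝ) : ℂ) ≠ 0 := by exact_mod_cast h1
        rw [hH]
        simp only [m0]
        push_cast
        field_simp
        linear_combination (-4 * (k i : ℂ) ^ 2 * coef s k) * Complex.I_sq
      simp only [h2, ← Finset.sum_mul, ← Complex.ofReal_sum]
      rw [show (∑ i, (k i : ℝ) ^ 2) * (S k)⁻¹ = 1 from mul_inv_cancel₀ h1]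
      simp

/-! ### The Hilbert space of mean-zero periodic fields. -/

theorem norm_sq_eq_comp_jac {n : ℕ} (w : H1perZero n) :
    ‖w‖ ^ 2 = ∑ i, ‖comp w i‖ ^ 2 + ‖jac w‖ ^ 2 := by
  rw [← Submodule.norm_coe, WithLp.prod_norm_sq_eq_of_L2, PiLp.norm_sq_eq_of_L2]
  rfl

/-- The Helmholtz-type identity `‖Dv‖² = ‖∇·v‖² + ½ ‖Dv - (Dv)ᵀ‖²` for periodic fields. -/
theorem norm_jac_sq {n : ℕ} (w : H1perZero n) :
    ‖jac w‖ ^ 2 = ‖divg w‖ ^ 2 + 1 / 2 * ∑ i, ∑ j, ‖jac w (i, j) - jac w (j, i)‖ ^ 2 := by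
  -- Two integrations by parts turn `∂_j w_i ∂_i w_j` into `∂_i w_i ∂_j w_j`, whose double sum is
  -- the square of the divergence.
  have h1 (i j : Fin n) : (inner ℝ (jac w (i, j)) (jac w (j, i)) : ℝ)
      = inner ℝ (jac w (i, i)) (jac w (j, j)) :=
    inner_weakPartial_comm (w.2.2 i j) (w.2.2 i i) (w.2.2 j j) (w.2.2 j i)
  have h2 : ‖divg w‖ ^ 2 = ∑ i, ∑ j, (inner ℝ (jac w (i, j)) (jac w (j, i)) : ℝ) := by
    rw [← real_inner_self_eq_norm_sq, divg, sum_inner]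
    simp only [inner_sum, h1]
  have h3 : ‖jac w‖ ^ 2 = ∑ i, ∑ j, ‖jac w (i, j)‖ ^ 2 := by
    rw [PiLp.norm_sq_eq_of_L2, Fintype.sum_prod_type]
  have h4 : ∑ i, ∑ j, ‖jac w (j, i)‖ ^ 2 = ∑ i, ∑ j, ‖jac w (i, j)‖ ^ 2 := Finset.sum_comm
  simp only [norm_sub_sq_real, Finset.sum_add_distrib, Finset.sum_sub_distrib, ← Finset.mul_sum]
  rw [h2, h3, h4]
  ring

theorem norm_divg_le {n : ℕ} (w : H1perZero n) : ‖divg w‖ ≤ ‖jac w‖ := by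
  refine le_of_sq_le_sq ?_ (norm_nonneg _)
  rw [norm_jac_sq]
  exact le_add_of_nonneg_right (by positivity)

/-- The Poincaré inequality in `H¹_{per,0}(Y;ℝⁿ)`. -/
theorem sum_norm_comp_sq_le {n : ℕ} (w : H1perZero n) :
    4 * Real.pi ^ 2 * ∑ i, ‖comp w i‖ ^ 2 ≤ ‖jac w‖ ^ 2 := by
  rw [PiLp.norm_sq_eq_of_L2, Fintype.sum_prod_type, Finset.mul_sum]
  exact Finset.sum_le_sum fun i _ => poincare (w.2.2 i) (w.2.1 i)

/-- Each defining condition equates continuous functionals, namely pairings with fixed `L²`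
functions. Completeness of the space follows, as Lax–Milgram requires. -/
theorem isClosed_H1perZero (n : ℕ) : IsClosed (H1perZero n : Set (L2Pair n)) := by
  have hI {u : L2Pair n → L2per n} (hu : Continuous u) {f : (Fin n → ℝ) → ℝ} (hf : Continuous f) :
      Continuous fun p => ∫ x in cell n, u p x * f x := by
    simp only [← inner_ofContinuous hf]
    exact hu.inner continuous_const
  have h1 (i : Fin n) : Continuous fun p : L2Pair n => p.fst i :=
    (PiLp.continuous_apply 2 _ i).comp (WithLp.continuous_fst 2 _ _)
  have h2 (i j : Fin n) : Continuous fun p : L2Pair n => p.snd (i, j) :=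
    (PiLp.continuous_apply 2 _ (i, j)).comp (WithLp.continuous_snd 2 _ _)
  have e : (H1perZero n : Set (L2Pair n)) = (⋂ i, {p | ∫ x in cell n, p.fst i x * 1 = 0}) ∩
      ⋂ (i) (j) (φ : (Fin n → ℝ) → ℝ) (_ : ContDiff ℝ ∞ φ) (_ : IsCellPeriodic φ),
        {p : L2Pair n | ∫ x in cell n, p.fst i x * partialDeriv j φ x
          = - ∫ x in cell n, p.snd (i, j) x * φ x} := by
    ext p
    simp [H1perZero, IsWeakPartial]
  rw [e]
  refine (isClosed_iInter fun i => isClosed_eq (hI (h1 i) continuous_const)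
    continuous_const).inter (isClosed_iInter fun i => isClosed_iInter fun j =>
    isClosed_iInter fun φ => isClosed_iInter fun hφ => isClosed_iInter fun _ =>
    isClosed_eq (hI (h1 i) (continuous_partialDeriv j hφ)) (hI (h2 i j) hφ.continuous).neg)

instance completeSpace_H1perZero (n : ℕ) : CompleteSpace (H1perZero n) :=
  (isClosed_H1perZero n).completeSpace_coe

/-! ### Pointwise consequences of the Cordes condition. -/

/-- Cauchy–Schwarz on matrix and vector entries taken together, so that diffusion and drift enter
through the single quantity that the Cordes condition controls. -/
theorem sum_mul_add_sum_mul_sq_le {n : ℕ} (a M : Fin n → Fin n → ℝ) (b v : Fin n → ℝ) :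
    ((∑ i, ∑ j, a i j * M i j) + ∑ i, b i * v i) ^ 2
      ≤ ((∑ i, ∑ j, a i j ^ 2) + ∑ i, b i ^ 2) * ((∑ i, ∑ j, M i j ^ 2) + ∑ i, v i ^ 2) := by
  have h := Finset.sum_mul_sq_le_sq_mul_sq (Finset.univ : Finset ((Fin n × Fin n) ⊕ Fin n))
    (Sum.elim (fun p => a p.1 p.2) b) (Sum.elim (fun p => M p.1 p.2) v)
  simpa [Fintype.sum_sum_type, Fintype.sum_prod_type] using h

theorem trace_sq_le {n : ℕ} (M : Matrix (Fin n) (Fin n) ℝ) : M.trace ^ 2 ≤ n * frobSq M := by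
  have h1 : M.trace ^ 2 ≤ n * ∑ i, M i i ^ 2 := by
    simpa [Matrix.trace] using sq_sum_le_card_mul_sum_sq (s := Finset.univ) (f := fun i => M i i)
  refine h1.trans ?_
  gcongr
  exact Finset.sum_le_sum fun i _ => Finset.single_le_sum (f := fun j => M i j ^ 2)
    (fun _ _ => sq_nonneg _) (Finset.mem_univ i)

theorem frobSq_sub_one {n : ℕ} (M : Matrix (Fin n) (Fin n) ℝ) :
    frobSq (M - 1) = frobSq M - 2 * M.trace + n := by
  have (i j : Fin n) : (M - 1) i j ^ 2
      = M i j ^ 2 - 2 * (if i = j then M i j else 0) + (if i = j then 1 else 0) := by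
    rw [Matrix.sub_apply, Matrix.one_apply]
    split_ifs <;> ring
  simp only [frobSq, this, Finset.sum_add_distrib, Finset.sum_sub_distrib, ← Finset.mul_sum]
  simp [Matrix.trace]

theorem frobSq_smul {n : ℕ} (c : ℝ) (M : Matrix (Fin n) (Fin n) ℝ) :
    frobSq (c • M) = c ^ 2 * frobSq M := by
  simp [frobSq, mul_pow, Finset.mul_sum]

theorem euclSq_smul {n : ℕ} (c : ℝ) (v : Fin n → ℝ) : euclSq (c • v) = c ^ 2 * euclSq v := by
  simp [euclSq, mul_pow, Finset.mul_sum]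

theorem euclSq_nonneg {n : ℕ} (v : Fin n → ℝ) : 0 ≤ euclSq v :=
  Finset.sum_nonneg fun _ _ => sq_nonneg _

theorem frobSq_nonneg {n : ℕ} (M : Matrix (Fin n) (Fin n) ℝ) : 0 ≤ frobSq M :=
  Finset.sum_nonneg fun _ _ => Finset.sum_nonneg fun _ _ => sq_nonneg _

theorem trace_pos_of_posSemidef_sub {n : ℕ} (hn : 0 < n) {M : Matrix (Fin n) (Fin n) ℝ} {c : ℝ}
    (hc : 0 < c) (h : (M - c • (1 : Matrix (Fin n) (Fin n) ℝ)).PosSemidef) : 0 < M.trace := by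
  have : NeZero n := ⟨hn.ne'⟩
  refine Finset.sum_pos (fun i _ => ?_) Finset.univ_nonempty
  have := h.diag_nonneg (i := i)
  simp only [Matrix.sub_apply, Matrix.smul_apply, Matrix.one_apply_eq, smul_eq_mul] at this
  simp only [Matrix.diag_apply]
  linarith

/-- This is what `κ` is made for: the Poincaré factor `1 + n/π²` times the Cordes defect `1 - δ`. -/
theorem one_sub_kappa (δ : ℝ) (n : ℕ) :
    1 - kappa δ n = (1 + n / Real.pi ^ 2) * (1 - δ) := by
  rw [kappa]
  have := Real.pi_pos
  have h : (n : ℝ) + Real.pi ^ 2 ≠ 0 := by positivity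
  field_simp
  ring

section Bounds

variable {n : ℕ} {A : (Fin n → ℝ) → Matrix (Fin n) (Fin n) ℝ} {b : (Fin n → ℝ) → Fin n → ℝ}
  {lam Lam δ : ℝ}

/-- The left side is `(tr A)² / (|A|² + |b|²)`, and `(tr A)² ≤ n |A|²`; no ellipticity ratio enters.
-/
theorem frobSq_Atil_add_le {x : Fin n → ℝ} (hF : 0 < frobSq (A x) + euclSq (b x)) :
    frobSq (Atil A b x) + euclSq (btil A b x) ≤ n := by
  have h := trace_sq_le (A x)
  have h1 : (A x).trace ^ 2 ≤ n * (frobSq (A x) + euclSq (b x)) := by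
    nlinarith [mul_nonneg n.cast_nonneg (euclSq_nonneg (b x)) (α := ℝ)]
  rw [Atil, btil, frobSq_smul, euclSq_smul, ← mul_add, renorm]
  rw [show ((A x).trace / (frobSq (A x) + euclSq (b x))) ^ 2 * (frobSq (A x) + euclSq (b x))
    = (A x).trace ^ 2 / (frobSq (A x) + euclSq (b x)) by field_simp]
  exact div_le_of_le_mul₀ hF.le n.cast_nonneg h1

/-- `γ` is the scalar `t` minimizing `|tA - I|² + |tb|²`, and the minimum is `n - (tr A)² / (|A|² +
|b|²)`. -/
theorem frobSq_Atil_sub_one_add_le {x : Fin n → ℝ} (hT : 0 < (A x).trace)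
    (hF : 0 < frobSq (A x) + euclSq (b x)) (hδ : 0 < (n : ℝ) - 1 + δ)
    (h : (frobSq (A x) + euclSq (b x)) / (A x).trace ^ 2 ≤ 1 / ((n : ℝ) - 1 + δ)) :
    frobSq (Atil A b x - 1) + euclSq (btil A b x) ≤ 1 - δ := by
  have h1 : (n : ℝ) - 1 + δ ≤ (A x).trace ^ 2 / (frobSq (A x) + euclSq (b x)) := by
    rw [div_le_div_iff₀ (by positivity) hδ] at h
    rw [le_div_iff₀ hF]
    linarith
  rw [frobSq_sub_one, Atil, btil, frobSq_smul, euclSq_smul, Matrix.trace_smul, renorm, smul_eq_mul]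
  have h2 : ((A x).trace / (frobSq (A x) + euclSq (b x))) ^ 2 * frobSq (A x)
      - 2 * ((A x).trace / (frobSq (A x) + euclSq (b x)) * (A x).trace) + n
      + ((A x).trace / (frobSq (A x) + euclSq (b x))) ^ 2 * euclSq (b x)
      = n - (A x).trace ^ 2 / (frobSq (A x) + euclSq (b x)) := by
    field_simp; ring
  linarith

namespace IsCordes

theorem delta_pos (hB : IsCordes A b lam Lam δ) : 0 < δ := lt_of_le_of_lt (by positivity) hB.lt_delta

theorem ae_bounds (hB : IsCordes A b lam Lam δ) (hn : 0 < n) : ∀ᵐ x ∂cellMeasure n,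
    frobSq (Atil A b x) + euclSq (btil A b x) ≤ n ∧
    frobSq (Atil A b x - 1) + euclSq (btil A b x) ≤ 1 - δ := by
  refine ae_restrict_of_ae ?_
  filter_upwards [hB.elliptic, hB.cordes] with x h1 h2
  have hT := trace_pos_of_posSemidef_sub hn hB.lam_pos h1.1
  have hn' : (1 : ℝ) ≤ n := by exact_mod_cast hn
  have hF : 0 < frobSq (A x) + euclSq (b x) := by
    have h3 := trace_sq_le (A x)
    -- A positive trace forces `|A|² > 0`, because `(tr A)² ≤ n |A|²`.
    have : 0 < frobSq (A x) := by
      by_contra hc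
      have : (n : ℝ) * frobSq (A x) ≤ 0 := mul_nonpos_of_nonneg_of_nonpos (by linarith) (not_lt.1 hc)
      nlinarith
    linarith [euclSq_nonneg (b x)]
  exact ⟨frobSq_Atil_add_le hF,
    frobSq_Atil_sub_one_add_le hT hF (by linarith [hB.delta_pos]) h2⟩

theorem aemeasurable_renorm (hB : IsCordes A b lam Lam δ) :
    AEMeasurable (renorm A b) (cellMeasure n) := by
  have hA (i j) : AEMeasurable (fun x => A x i j) (cellMeasure n) :=
    (hB.memLp_A i j).aestronglyMeasurable.aemeasurable.restrict
  have hb (i) : AEMeasurable (fun x => b x i) (cellMeasure n) :=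
    (hB.memLp_b i).aestronglyMeasurable.aemeasurable.restrict
  unfold renorm frobSq euclSq Matrix.trace
  simp only [Matrix.diag_apply]
  fun_prop

theorem memLp_Atil (hB : IsCordes A b lam Lam δ) (hn : 0 < n) (i j : Fin n) :
    MemLp (fun x => Atil A b x i j) ∞ (cellMeasure n) := by
  refine memLp_top_of_bound (hB.aemeasurable_renorm.mul
    (hB.memLp_A i j).aestronglyMeasurable.aemeasurable.restrict).aestronglyMeasurable √n ?_
  filter_upwards [hB.ae_bounds hn] with x hx
  refine Real.abs_le_sqrt (le_trans ?_ ((le_add_of_nonneg_right (euclSq_nonneg _)).trans hx.1))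
  exact (Finset.single_le_sum (f := fun j => Atil A b x i j ^ 2) (fun _ _ => sq_nonneg _)
    (Finset.mem_univ j)).trans (Finset.single_le_sum (f := fun i => ∑ j, Atil A b x i j ^ 2)
    (fun _ _ => Finset.sum_nonneg fun _ _ => sq_nonneg _) (Finset.mem_univ i))

theorem memLp_btil (hB : IsCordes A b lam Lam δ) (hn : 0 < n) (i : Fin n) :
    MemLp (fun x => btil A b x i) ∞ (cellMeasure n) := by
  refine memLp_top_of_bound (hB.aemeasurable_renorm.mul
    (hB.memLp_b i).aestronglyMeasurable.aemeasurable.restrict).aestronglyMeasurable √n ?_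
  filter_upwards [hB.ae_bounds hn] with x hx
  refine Real.abs_le_sqrt (le_trans ?_ ((le_add_of_nonneg_left (frobSq_nonneg _)).trans hx.1))
  exact Finset.single_le_sum (f := fun i => btil A b x i ^ 2) (fun _ _ => sq_nonneg _)
    (Finset.mem_univ i)

theorem memLp_ndOp (hB : IsCordes A b lam Lam δ) (hn : 0 < n)
    (M : Fin n → Fin n → L2per n) (v : Fin n → L2per n) :
    MemLp (ndOp A b M v) 2 (cellMeasure n) := by
  refine MemLp.add (memLp_finsetSum _ fun i _ => memLp_finsetSum _ fun j _ => ?_)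
    (memLp_finsetSum _ fun i _ => ?_)
  · exact (Lp.memLp (M i j)).mul (hB.memLp_Atil hn i j)
  · exact (Lp.memLp (v i)).mul (hB.memLp_btil hn i)

theorem lam_le_Lam (hB : IsCordes A b lam Lam δ) (hn : 0 < n) : lam ≤ Lam := by
  obtain ⟨x, h1, h2⟩ := hB.elliptic.exists
  have h3 := h1.diag_nonneg (i := ⟨0, hn⟩)
  have h4 := h2.diag_nonneg (i := ⟨0, hn⟩)
  simp only [Matrix.sub_apply, Matrix.smul_apply, Matrix.one_apply_eq, smul_eq_mul] at h3 h4
  linarith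

theorem sqrt_one_sub_kappa_lt_one (hB : IsCordes A b lam Lam δ) :
    √(1 - kappa δ n) < 1 := by
  have := Real.pi_pos
  have h : 0 < kappa δ n := mul_pos (sub_pos.2 hB.lt_delta) (by positivity)
  rw [Real.sqrt_lt' one_pos]
  linarith

end IsCordes

end Bounds

/-! ### The nondivergence operator as a perturbation of the divergence. -/

/-- The entry `∂_j w_i` of the Jacobian as a continuous linear map. -/
def jacEntryL {n : ℕ} (i j : Fin n) : H1perZero n →L[ℝ] L2per n :=
  (PiLp.proj 2 (𝕜 := ℝ) (fun _ : Fin n × Fin n => L2per n) (i, j)).comp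
    ((WithLp.sndL 2 ℝ _ _).comp (H1perZero n).subtypeL)

@[simp]
theorem jacEntryL_apply {n : ℕ} (i j : Fin n) (w : H1perZero n) :
    jacEntryL i j w = jac w (i, j) := rfl

/-- The divergence as a continuous linear map. -/
def divgL (n : ℕ) : H1perZero n →L[ℝ] L2per n := ∑ i, jacEntryL i i

@[simp]
theorem divgL_apply {n : ℕ} (w : H1perZero n) : divgL n w = divg w := by
  simp [divgL, divg]

/-- The entries of the skew part `Dw - (Dw)ᵀ`. -/
def curlL {n : ℕ} (i j : Fin n) : H1perZero n →L[ℝ] L2per n := jacEntryL i j - jacEntryL j i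

theorem curlL_apply {n : ℕ} (i j : Fin n) (w : H1perZero n) :
    curlL i j w = jac w (i, j) - jac w (j, i) := rfl

theorem norm_sq_L2 {n : ℕ} (u : L2per n) : ‖u‖ ^ 2 = ∫ x in cell n, u x ^ 2 := by
  rw [← real_inner_self_eq_norm_sq, inner_L2]; simp only [sq]

theorem integrable_sq {n : ℕ} (u : L2per n) : Integrable (fun x => u x ^ 2) (cellMeasure n) :=
  (Lp.memLp u).integrable_sq

theorem norm_sq_eq_integral {n : ℕ} (w : H1perZero n) :
    ‖w‖ ^ 2 = ∫ x in cell n, (∑ i, ∑ j, jac w (i, j) x ^ 2) + ∑ i, comp w i x ^ 2 := by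
  rw [norm_sq_eq_comp_jac, PiLp.norm_sq_eq_of_L2, Fintype.sum_prod_type, add_comm, integral_add]
  · rw [integral_finsetSum _ fun i _ => integrable_finsetSum _ fun j _ => integrable_sq _,
      integral_finsetSum _ fun i _ => integrable_sq _]
    simp only [norm_sq_L2, integral_finsetSum _ fun j _ => integrable_sq _]
  · exact integrable_finsetSum _ fun i _ => integrable_finsetSum _ fun j _ => integrable_sq _
  · exact integrable_finsetSum _ fun i _ => integrable_sq _

theorem norm_sq_le_of_ae_le {n : ℕ} {u : L2per n} {w : H1perZero n} {C : ℝ}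
    (h : ∀ᵐ x ∂cellMeasure n,
      u x ^ 2 ≤ C * ((∑ i, ∑ j, jac w (i, j) x ^ 2) + ∑ i, comp w i x ^ 2)) :
    ‖u‖ ^ 2 ≤ C * ‖w‖ ^ 2 := by
  rw [norm_sq_L2, norm_sq_eq_integral, ← integral_const_mul]
  refine integral_mono_ae (integrable_sq u) (Integrable.const_mul (Integrable.add ?_ ?_) _) h
  · exact integrable_finsetSum _ fun i _ => integrable_finsetSum _ fun j _ => integrable_sq _
  · exact integrable_finsetSum _ fun i _ => integrable_sq _

/-- The Poincaré constant `1/(4π²)` is relaxed to `n/π²`, the value built into `kappa`. -/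
theorem norm_sq_le_mul_norm_jac_sq {n : ℕ} (hn : 0 < n) (w : H1perZero n) :
    ‖w‖ ^ 2 ≤ (1 + n / Real.pi ^ 2) * ‖jac w‖ ^ 2 := by
  have h := sum_norm_comp_sq_le w
  have hpi := Real.pi_pos
  have hn' : (1 : ℝ) ≤ n := by exact_mod_cast hn
  have h0 : 0 ≤ ∑ i, ‖comp w i‖ ^ 2 := Finset.sum_nonneg fun _ _ => sq_nonneg _
  have h1 : ∑ i, ‖comp w i‖ ^ 2 ≤ n / Real.pi ^ 2 * ‖jac w‖ ^ 2 := by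
    rw [div_mul_eq_mul_div, le_div_iff₀ (by positivity)]
    nlinarith [mul_nonneg h0 (sq_nonneg Real.pi),
      mul_nonneg (sub_nonneg.2 hn') (sq_nonneg ‖jac w‖)]
  rw [norm_sq_eq_comp_jac]
  linarith

section Operator

variable {n : ℕ} {A : (Fin n → ℝ) → Matrix (Fin n) (Fin n) ℝ} {b : (Fin n → ℝ) → Fin n → ℝ}
  {lam Lam δ : ℝ}

namespace IsCordes

/-- The operator `w ↦ Ã : Dw + b̃ · w` from `H¹_{per,0}` to `L²_per`, as a linear map. -/
def ndLin (hB : IsCordes A b lam Lam δ) (hn : 0 < n) : H1perZero n →ₗ[ℝ] L2per n where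
  toFun w := (hB.memLp_ndOp hn (fun i j => jac w (i, j)) (comp w)).toLp
  map_add' v w := by
    rw [← MemLp.toLp_add, MemLp.toLp_eq_toLp_iff]
    have h1 : ∀ᵐ x ∂cellMeasure n, ∀ i j, jac (v + w) (i, j) x = jac v (i, j) x + jac w (i, j) x :=
      ae_all_iff.2 fun i => ae_all_iff.2 fun j => Lp.coeFn_add (jac v (i, j)) (jac w (i, j))
    have h2 : ∀ᵐ x ∂cellMeasure n, ∀ i, comp (v + w) i x = comp v i x + comp w i x :=
      ae_all_iff.2 fun i => Lp.coeFn_add (comp v i) (comp w i)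
    filter_upwards [h1, h2] with x h1 h2
    simp only [ndOp, h1, h2, Pi.add_apply, mul_add, Finset.sum_add_distrib]
    ring
  map_smul' c w := by
    rw [RingHom.id_apply, ← MemLp.toLp_const_smul, MemLp.toLp_eq_toLp_iff]
    have h1 : ∀ᵐ x ∂cellMeasure n, ∀ i j, jac (c • w) (i, j) x = c * jac w (i, j) x :=
      ae_all_iff.2 fun i => ae_all_iff.2 fun j => Lp.coeFn_smul c (jac w (i, j))
    have h2 : ∀ᵐ x ∂cellMeasure n, ∀ i, comp (c • w) i x = c * comp w i x :=
      ae_all_iff.2 fun i => Lp.coeFn_smul c (comp w i)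
    filter_upwards [h1, h2] with x h1 h2
    simp only [ndOp, h1, h2, Pi.smul_apply, smul_eq_mul, mul_add, Finset.mul_sum]
    simp only [mul_left_comm c]

variable (hB : IsCordes A b lam Lam δ) (hn : 0 < n)

theorem coeFn_ndLin (w : H1perZero n) :
    hB.ndLin hn w =ᵐ[cellMeasure n] ndOp A b (fun i j => jac w (i, j)) (comp w) :=
  (hB.memLp_ndOp hn _ _).coeFn_toLp

theorem norm_ndLin_sq_le (w : H1perZero n) : ‖hB.ndLin hn w‖ ^ 2 ≤ n * ‖w‖ ^ 2 := by
  refine norm_sq_le_of_ae_le ?_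
  filter_upwards [hB.coeFn_ndLin hn w, hB.ae_bounds hn] with x h1 h2
  rw [h1, ndOp]
  refine (sum_mul_add_sum_mul_sq_le (Atil A b x) (fun i j => jac w (i, j) x) (btil A b x)
    (fun i => comp w i x)).trans ?_
  gcongr
  exact h2.1

theorem norm_ndLin_le (w : H1perZero n) : ‖hB.ndLin hn w‖ ≤ √n * ‖w‖ := by
  refine le_of_sq_le_sq ?_ (by positivity)
  rw [mul_pow, Real.sq_sqrt n.cast_nonneg]
  exact hB.norm_ndLin_sq_le hn w

/-- The operator `w ↦ Ã : Dw + b̃ · w` as a continuous linear map. -/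
def ndL : H1perZero n →L[ℝ] L2per n := (hB.ndLin hn).mkContinuous √n (hB.norm_ndLin_le hn)

theorem coeFn_ndL (w : H1perZero n) :
    hB.ndL hn w =ᵐ[cellMeasure n] ndOp A b (fun i j => jac w (i, j)) (comp w) :=
  hB.coeFn_ndLin hn w

theorem norm_ndL_le (w : H1perZero n) :
    ‖hB.ndL hn w‖ ≤ √n * √(1 + n / Real.pi ^ 2) * ‖jac w‖ := by
  refine (hB.norm_ndLin_le hn w).trans ?_
  rw [mul_assoc]
  gcongr
  refine le_of_sq_le_sq ?_ (by positivity)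
  rw [mul_pow, Real.sq_sqrt (by positivity)]
  exact norm_sq_le_mul_norm_jac_sq hn w

/-- The Cordes condition: the operator is close to the divergence. -/
theorem norm_ndL_sub_divg_le (w : H1perZero n) :
    ‖hB.ndL hn w - divg w‖ ≤ √(1 - kappa δ n) * ‖jac w‖ := by
  have hδ : 0 ≤ 1 - δ := sub_nonneg.2 hB.delta_le
  have h : ‖hB.ndL hn w - divg w‖ ^ 2 ≤ (1 - δ) * ‖w‖ ^ 2 := by
    refine norm_sq_le_of_ae_le ?_
    have hd : divg w =ᵐ[cellMeasure n] fun x => ∑ i, jac w (i, i) x := by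
      filter_upwards [Lp.coeFn_finsetSum Finset.univ fun i => jac w (i, i)] with x hx
      rw [divg, hx, Finset.sum_apply]
    filter_upwards [hB.coeFn_ndL hn w, hB.ae_bounds hn, hd,
      Lp.coeFn_sub (hB.ndL hn w) (divg w)] with x h1 h2 h3 h4
    -- `∇·w = I : Dw`, so the difference has coefficients `Ã - I` and `b̃`.
    have h5 : ndOp A b (fun i j => jac w (i, j)) (comp w) x - ∑ i, jac w (i, i) x
        = (∑ i, ∑ j, (Atil A b x - 1) i j * jac w (i, j) x)
          + ∑ i, btil A b x i * comp w i x := by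
      simp only [ndOp, Matrix.sub_apply, sub_mul, Finset.sum_sub_distrib, Matrix.one_apply,
        ite_mul, one_mul, zero_mul, Finset.sum_ite_eq, Finset.mem_univ, if_true]
      ring
    rw [h4, Pi.sub_apply, h1, h3, h5]
    refine (sum_mul_add_sum_mul_sq_le (Atil A b x - 1) (fun i j => jac w (i, j) x) (btil A b x)
      (fun i => comp w i x)).trans ?_
    gcongr
    exact h2.2
  refine le_of_sq_le_sq ?_ (by positivity)
  have hk := one_sub_kappa δ n
  -- `δ ≤ 1` makes `1 - κ` nonnegative, so the square root is genuine.
  rw [mul_pow, Real.sq_sqrt (by rw [hk]; positivity), hk]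
  refine h.trans ?_
  rw [mul_comm (1 + _) (1 - δ), mul_assoc]
  gcongr
  exact norm_sq_le_mul_norm_jac_sq hn w

end IsCordes

end Operator

/-! ### The skew part, gradients and constants. -/

/-- By `norm_jac_sq`, `½ ‖Dw - (Dw)ᵀ‖² ≤ ‖Dw‖²`; Cauchy–Schwarz then gives the skew term the
constant `1`. -/
theorem abs_half_sum_inner_le {n : ℕ} (v w : H1perZero n) :
    |1 / 2 * ∑ i, ∑ j, (inner ℝ (curlL i j v) (curlL i j w) : ℝ)| ≤ ‖jac v‖ * ‖jac w‖ := by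
  have hc (u : H1perZero n) : ∑ i, ∑ j, ‖curlL i j u‖ ^ 2 ≤ 2 * ‖jac u‖ ^ 2 := by
    have := norm_jac_sq u
    simp only [curlL_apply]
    nlinarith [sq_nonneg ‖divg u‖]
  have h1 : |∑ i, ∑ j, (inner ℝ (curlL i j v) (curlL i j w) : ℝ)|
      ≤ ∑ p : Fin n × Fin n, ‖curlL p.1 p.2 v‖ * ‖curlL p.1 p.2 w‖ := by
    rw [← Fintype.sum_prod_type']
    exact (Finset.abs_sum_le_sum_abs _ _).trans
      (Finset.sum_le_sum fun p _ => abs_real_inner_le_norm _ _)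
  have h2 := Finset.sum_mul_sq_le_sq_mul_sq (Finset.univ : Finset (Fin n × Fin n))
    (fun p => ‖curlL p.1 p.2 v‖) (fun p => ‖curlL p.1 p.2 w‖)
  rw [Fintype.sum_prod_type' (f := fun i j => ‖curlL i j v‖ ^ 2),
    Fintype.sum_prod_type' (f := fun i j => ‖curlL i j w‖ ^ 2)] at h2
  have h3 : ∑ p : Fin n × Fin n, ‖curlL p.1 p.2 v‖ * ‖curlL p.1 p.2 w‖
      ≤ 2 * (‖jac v‖ * ‖jac w‖) := by
    refine le_of_sq_le_sq (h2.trans ?_) (by positivity)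
    calc _ ≤ (2 * ‖jac v‖ ^ 2) * (2 * ‖jac w‖ ^ 2) :=
          mul_le_mul (hc v) (hc w) (by positivity) (by positivity)
      _ = _ := by ring
  rw [abs_mul, abs_of_pos (by norm_num : (0 : ℝ) < 1 / 2)]
  linarith

/-- The gradient of an `H²_per` function, as an element of `H¹_{per,0}(Y;ℝⁿ)`. -/
def IsH2per.gradient {n : ℕ} {φ : L2per n} {g : Fin n → L2per n} {H : Fin n → Fin n → L2per n}
    (h : IsH2per φ g H) : H1perZero n :=
  ⟨WithLp.toLp 2 (WithLp.toLp 2 g, WithLp.toLp 2 fun p => H p.1 p.2),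
    fun i => (h.1 i).integral_eq_zero, fun i j => h.2 i j⟩

theorem IsH2per.curlL_gradient {n : ℕ} {φ : L2per n} {g : Fin n → L2per n}
    {H : Fin n → Fin n → L2per n} (h : IsH2per φ g H) (i j : Fin n) :
    curlL i j h.gradient = 0 :=
  sub_eq_zero.2 (h.symm i j)

/-- The constant function `1`. -/
abbrev constOne (n : ℕ) : L2per n := Lp.const 2 (cellMeasure n) (1 : ℝ)

theorem coeFn_constOne (n : ℕ) : constOne n =ᵐ[cellMeasure n] fun _ => (1 : ℝ) :=
  Lp.coeFn_const _ _ _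

theorem inner_constOne {n : ℕ} (u : L2per n) : inner ℝ (constOne n) u = ∫ x in cell n, u x := by
  rw [inner_L2]
  refine integral_congr_ae ?_
  filter_upwards [coeFn_constOne n] with x hx
  rw [hx, one_mul]

theorem inner_constOne_self (n : ℕ) : inner ℝ (constOne n) (constOne n) = (1 : ℝ) := by
  rw [inner_constOne, integral_congr_ae (coeFn_constOne n), integral_const, smul_eq_mul, mul_one,
    measureReal_restrict_apply_univ, measureReal_def, cell, Real.volume_pi_Ioo]
  simp

theorem inner_constOne_divg {n : ℕ} (w : H1perZero n) :
    inner ℝ (constOne n) (divg w) = (0 : ℝ) := by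
  rw [divg, inner_sum]
  exact Finset.sum_eq_zero fun i _ => by
    rw [inner_constOne]; exact (w.2.2 i i).integral_eq_zero

/-! ### Lax–Milgram, the Fokker–Planck solution and Céa's estimate. -/

/-- The Lax–Milgram theorem on a closed subspace. -/
theorem exists_eq_of_coercive_of_isClosed {E : Type*} [NormedAddCommGroup E]
    [InnerProductSpace ℝ E] [CompleteSpace E] (B : E →L[ℝ] E →L[ℝ] ℝ) {c : ℝ} (hc : 0 < c)
    (hB : ∀ w, c * ‖w‖ * ‖w‖ ≤ B w w) {P : Submodule ℝ E} (hP : IsClosed (P : Set E))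
    (f : E →L[ℝ] ℝ) : ∃ ρ ∈ P, ∀ w ∈ P, B ρ w = f w := by
  have : CompleteSpace P := hP.completeSpace_coe
  have hco : IsCoercive (B.bilinearComp P.subtypeL P.subtypeL) := ⟨c, hc, fun w => hB w⟩
  let ρ : P := hco.continuousLinearEquivOfBilin.symm
    ((InnerProductSpace.toDual ℝ P).symm (f.comp P.subtypeL))
  refine ⟨ρ, ρ.2, fun w hw => ?_⟩
  have h := hco.continuousLinearEquivOfBilin_apply ρ ⟨w, hw⟩
  rw [ContinuousLinearEquiv.apply_symm_apply, InnerProductSpace.toDual_symm_apply] at h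
  exact h.symm

/-- The inner product of `L²_per(Y)` as a continuous bilinear map. -/
def innerL (n : ℕ) : L2per n →L[ℝ] L2per n →L[ℝ] ℝ :=
  (isBoundedBilinearMap_inner (𝕜 := ℝ)).toContinuousLinearMap

@[simp]
theorem innerL_apply {n : ℕ} (u v : L2per n) : innerL n u v = inner ℝ u v := rfl

namespace IsCordes

variable {n : ℕ} {A : (Fin n → ℝ) → Matrix (Fin n) (Fin n) ℝ} {b : (Fin n → ℝ) → Fin n → ℝ}
  {lam Lam δ : ℝ} (hB : IsCordes A b lam Lam δ) (hn : 0 < n)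

/-- The form `B₂` as a continuous bilinear form. -/
@[irreducible]
def formL : H1perZero n →L[ℝ] H1perZero n →L[ℝ] ℝ :=
  (innerL n).bilinearComp (divgL n) (hB.ndL hn)
    + (1 / 2 : ℝ) • ∑ i, ∑ j, (innerL n).bilinearComp (curlL i j) (curlL i j)

theorem formL_apply (v w : H1perZero n) : hB.formL hn v w
    = inner ℝ (divg v) (hB.ndL hn w)
      + 1 / 2 * ∑ i, ∑ j, inner ℝ (curlL i j v) (curlL i j w) := by
  simp [formL, sum_apply]

theorem integral_mul_ndOp (r : L2per n) (w : H1perZero n) :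
    ∫ x in cell n, r x * ndOp A b (fun i j => jac w (i, j)) (comp w) x
      = inner ℝ r (hB.ndL hn w) := by
  rw [inner_L2]
  refine integral_congr_ae ?_
  filter_upwards [hB.coeFn_ndL hn w] with x hx
  rw [hx]

theorem B2_eq (v w : H1perZero n) : B2 A b v w = hB.formL hn v w := by
  rw [B2, hB.integral_mul_ndOp hn, formL_apply]
  congr 2
  have h (i j : Fin n) (u : H1perZero n) :
      curlL i j u =ᵐ[cellMeasure n] fun x => jac u (i, j) x - jac u (j, i) x :=
    Lp.coeFn_sub _ _
  have e (i j : Fin n) : (fun x => curlL i j v x * curlL i j w x) =ᵐ[cellMeasure n]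
      fun x => (jac v (i, j) x - jac v (j, i) x) * (jac w (i, j) x - jac w (j, i) x) :=
    (h i j v).mul (h i j w)
  have hi (i j : Fin n) : Integrable (fun x =>
      (jac v (i, j) x - jac v (j, i) x) * (jac w (i, j) x - jac w (j, i) x)) (cellMeasure n) :=
    ((Lp.memLp (curlL i j v)).integrable_mul (Lp.memLp (curlL i j w))).congr (e i j)
  rw [integral_finsetSum _ fun i _ => integrable_finsetSum _ fun j _ => hi i j]
  refine Finset.sum_congr rfl fun i _ => ?_
  rw [integral_finsetSum _ fun j _ => hi i j]
  refine Finset.sum_congr rfl fun j _ => ?_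
  rw [inner_L2, integral_congr_ae (e i j)]

theorem loadFun_eq (w : H1perZero n) :
    loadFun A b w = inner ℝ (constOne n) (hB.ndL hn w) := by
  rw [inner_constOne, loadFun]
  exact (integral_congr_ae (hB.coeFn_ndL hn w)).symm

/-- Replacing `L w` by `∇·w` makes the form equal to `‖Dw‖²` by `norm_jac_sq`. The error is at most
`‖∇·w‖ √(1 - κ) ‖Dw‖`, and `‖∇·w‖ ≤ ‖Dw‖`. -/
theorem le_formL_self (w : H1perZero n) :
    (1 - √(1 - kappa δ n)) * ‖jac w‖ ^ 2 ≤ hB.formL hn w w := by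
  have h1 : inner ℝ (divg w) (hB.ndL hn w)
      = ‖divg w‖ ^ 2 + (inner ℝ (divg w) (hB.ndL hn w - divg w) : ℝ) := by
    rw [inner_sub_right, real_inner_self_eq_norm_sq]; ring
  have h2 := norm_jac_sq w
  have h3 : |(inner ℝ (divg w) (hB.ndL hn w - divg w) : ℝ)|
      ≤ ‖jac w‖ * (√(1 - kappa δ n) * ‖jac w‖) :=
    (abs_real_inner_le_norm _ _).trans (mul_le_mul (norm_divg_le w)
      (hB.norm_ndL_sub_divg_le hn w) (norm_nonneg _) (norm_nonneg _))
  rw [formL_apply, h1]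
  simp only [real_inner_self_eq_norm_sq, curlL_apply]
  have h4 := (abs_le.1 h3).1
  linarith

theorem formL_le (v w : H1perZero n) :
    hB.formL hn v w ≤ (1 + √n * √(1 + n / Real.pi ^ 2)) * (‖jac v‖ * ‖jac w‖) := by
  have h1 := (le_abs_self _).trans (abs_half_sum_inner_le v w)
  have h2 : (inner ℝ (divg v) (hB.ndL hn w) : ℝ)
      ≤ ‖jac v‖ * (√n * √(1 + n / Real.pi ^ 2) * ‖jac w‖) :=
    (real_inner_le_norm _ _).trans (mul_le_mul (norm_divg_le v)
      (hB.norm_ndL_le hn w) (norm_nonneg _) (norm_nonneg _))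
  rw [formL_apply]
  linarith

/-- Coercivity in the full `H¹` norm, for Lax–Milgram only; the error estimate uses the sharper
`le_formL_self`. -/
theorem coercive (w : H1perZero n) :
    (1 - √(1 - kappa δ n)) / (1 + n / Real.pi ^ 2) * ‖w‖ * ‖w‖ ≤ hB.formL hn w w := by
  have h1 : 0 < 1 - √(1 - kappa δ n) := sub_pos.2 hB.sqrt_one_sub_kappa_lt_one
  have h2 : 0 < 1 + (n : ℝ) / Real.pi ^ 2 := by positivity
  refine le_trans ?_ (hB.le_formL_self hn w)
  have := norm_sq_le_mul_norm_jac_sq hn w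
  rw [mul_assoc, ← sq, div_mul_eq_mul_div, div_le_iff₀ h2, mul_assoc]
  gcongr
  linarith

theorem eq_zero_of_formL_self {w : H1perZero n} (h : hB.formL hn w w = 0) : w = 0 := by
  have h1 := hB.le_formL_self hn w
  have h2 := hB.sqrt_one_sub_kappa_lt_one
  have h3 : ‖jac w‖ ^ 2 ≤ 0 := by
    by_contra hc
    nlinarith [mul_pos (sub_pos.2 h2) (not_le.1 hc)]
  have h4 := norm_sq_le_mul_norm_jac_sq hn w
  have h5 : ‖w‖ ^ 2 ≤ 0 := h4.trans (mul_nonpos_of_nonneg_of_nonpos (by positivity) h3)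
  exact norm_eq_zero.1 (pow_eq_zero_iff two_ne_zero |>.1 (le_antisymm h5 (sq_nonneg _)))

theorem isGalerkinSol_iff {P : Submodule ℝ (H1perZero n)} {ρ : H1perZero n} :
    IsGalerkinSol A b P ρ ↔ ρ ∈ P ∧
      ∀ w ∈ P, hB.formL hn ρ w = inner ℝ (constOne n) (hB.ndL hn w) := by
  simp only [IsGalerkinSol, hB.B2_eq hn, hB.loadFun_eq hn]

theorem isGalerkinSol_unique (hB : IsCordes A b lam Lam δ) (hn : 0 < n)
    {P : Submodule ℝ (H1perZero n)} {ρ ρ' : H1perZero n}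
    (h : IsGalerkinSol A b P ρ) (h' : IsGalerkinSol A b P ρ') : ρ' = ρ := by
  rw [hB.isGalerkinSol_iff hn] at h h'
  refine sub_eq_zero.1 (hB.eq_zero_of_formL_self hn ?_)
  have hm := P.sub_mem h'.1 h.1
  rw [ContinuousLinearMap.map_sub₂, h.2 _ hm, h'.2 _ hm, sub_self]

/-- The Lax–Milgram theorem for the Galerkin problem. -/
theorem exists_isGalerkinSol (hB : IsCordes A b lam Lam δ) (hn : 0 < n)
    {P : Submodule ℝ (H1perZero n)}
    (hP : IsClosed (P : Set (H1perZero n))) : ∃ ρ, IsGalerkinSol A b P ρ := by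
  have hc : 0 < (1 - √(1 - kappa δ n)) / (1 + n / Real.pi ^ 2) :=
    div_pos (sub_pos.2 hB.sqrt_one_sub_kappa_lt_one) (by positivity)
  let f : H1perZero n →L[ℝ] ℝ := (innerL n (constOne n)).comp (hB.ndL hn)
  obtain ⟨ρ, hρ, h⟩ := exists_eq_of_coercive_of_isClosed (E := H1perZero n)
    (hB.formL hn) hc (hB.coercive hn) hP f
  refine ⟨ρ, (hB.isGalerkinSol_iff hn).2 ⟨hρ, fun w hw => ?_⟩⟩
  rw [h w hw, ContinuousLinearMap.comp_apply, innerL_apply]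

/-- For `w = ∇φ` the skew term drops out, leaving `∫ (∇·ρ) L(∇φ) = ∫ L(∇φ)`. The mean is `1` because
a periodic divergence integrates to zero. -/
theorem isRenormFPKSol_of_isGalerkinSol (hB : IsCordes A b lam Lam δ) (hn : 0 < n)
    {ρ : H1perZero n} (h : IsGalerkinSol A b ⊤ ρ) :
    IsRenormFPKSol A b (constOne n - divg ρ) := by
  rw [hB.isGalerkinSol_iff hn] at h
  refine ⟨fun φ g H hφ => ?_, ?_⟩
  · have h1 := h.2 hφ.gradient trivial
    rw [formL_apply] at h1
    simp only [hφ.curlL_gradient, inner_zero_right, Finset.sum_const_zero, mul_zero,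
      add_zero] at h1
    refine (hB.integral_mul_ndOp hn _ hφ.gradient).trans ?_
    rw [inner_sub_left, h1, sub_self]
  · rw [← inner_constOne, inner_sub_right, inner_constOne_self, inner_constOne_divg, sub_zero]

/-- With `r' - r = Δφ`, the equation tested with `φ` itself reads `B₂(∇φ,∇φ) = 0`, so coercivity
gives `∇φ = 0`. -/
theorem isRenormFPKSol_unique (hB : IsCordes A b lam Lam δ) (hn : 0 < n)
    {r r' : L2per n} (h : IsRenormFPKSol A b r)
    (h' : IsRenormFPKSol A b r') : r' = r := by
  have hs : ∫ x in cell n, (r' - r : L2per n) x = 0 := by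
    rw [← inner_constOne, inner_sub_right, inner_constOne, inner_constOne, h.2, h'.2, sub_self]
  obtain ⟨φ, g, H, hφ, hs'⟩ := exists_laplacian_eq (r' - r) hs
  have hd : divg hφ.gradient = r' - r := hs'
  have h0 : inner ℝ (r' - r) (hB.ndL hn hφ.gradient) = (0 : ℝ) := by
    rw [inner_sub_left, ← hB.integral_mul_ndOp hn, ← hB.integral_mul_ndOp hn]
    exact (congrArg₂ (· - ·) (h'.1 φ g H hφ) (h.1 φ g H hφ)).trans (sub_self 0)
  have h1 := hB.le_formL_self hn hφ.gradient
  refine sub_eq_zero.1 ?_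
  rw [← hd]
  have h2 : hφ.gradient = 0 := hB.eq_zero_of_formL_self hn (by
    rw [formL_apply, hd, h0]
    simp [hφ.curlL_gradient])
  rw [h2, ← divgL_apply, map_zero]

/-- Céa's lemma for the Galerkin problem. -/
theorem norm_jac_sub_le (hB : IsCordes A b lam Lam δ) (hn : 0 < n)
    {P : Submodule ℝ (H1perZero n)} {ρ ρh : H1perZero n}
    (h : IsGalerkinSol A b ⊤ ρ) (hh : IsGalerkinSol A b P ρh) (w : P) :
    (1 - √(1 - kappa δ n)) * ‖jac (ρ - ρh)‖
      ≤ (1 + √n * √(1 + n / Real.pi ^ 2)) * ‖jac (ρ - (w : H1perZero n))‖ := by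
  rw [hB.isGalerkinSol_iff hn] at h hh
  have h1 : hB.formL hn (ρ - ρh) (ρ - ρh) = hB.formL hn (ρ - ρh) (ρ - w) := by
    have hm : ρh - (w : H1perZero n) ∈ P := P.sub_mem hh.1 w.2
    -- Galerkin orthogonality.
    have h2 : hB.formL hn (ρ - ρh) (ρh - w) = 0 := by
      rw [ContinuousLinearMap.map_sub₂, h.2 _ trivial, hh.2 _ hm, sub_self]
    rw [show ρ - (w : H1perZero n) = (ρ - ρh) + (ρh - w) by abel, map_add, h2, add_zero]
  have h2 := hB.le_formL_self hn (ρ - ρh)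
  have h3 := hB.formL_le hn (ρ - ρh) (ρ - w)
  -- One factor `‖D(ρ - ρ_h)‖` is to be cancelled, so its vanishing is treated apart.
  rcases (norm_nonneg (jac (ρ - ρh))).eq_or_lt with h0 | h0
  · rw [← h0, mul_zero]; positivity
  · refine le_of_mul_le_mul_right ?_ h0
    linarith

theorem errConst_pos (hB : IsCordes A b lam Lam δ) :
    0 < errConst lam Lam δ n := by
  have := hB.lam_pos
  have := hB.Lam_pos
  exact div_pos (by positivity) (sub_pos.2 hB.sqrt_one_sub_kappa_lt_one)

theorem norm_divg_sub_le (hB : IsCordes A b lam Lam δ) (hn : 0 < n)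
    {P : Submodule ℝ (H1perZero n)} {ρ ρh : H1perZero n}
    (h : IsGalerkinSol A b ⊤ ρ) (hh : IsGalerkinSol A b P ρh) :
    ‖divg (ρ - ρh)‖ ≤ errConst lam Lam δ n * ⨅ w : P, ‖jac (ρ - (w : H1perZero n))‖ := by
  rw [Real.mul_iInf_of_nonneg (errConst_pos hB).le]
  refine le_ciInf fun w => (norm_divg_le _).trans ?_
  have h1 : 0 < 1 - √(1 - kappa δ n) := sub_pos.2 hB.sqrt_one_sub_kappa_lt_one
  -- The estimate holds without the ratio `Λ/λ`; inserting this factor, which is at least `1`, only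
  -- enlarges the constant.
  have h2 : 1 ≤ Lam / lam := (one_le_div hB.lam_pos).2 (hB.lam_le_Lam hn)
  rw [errConst, div_mul_eq_mul_div, le_div_iff₀ h1, mul_comm]
  refine (hB.norm_jac_sub_le hn h hh w).trans ?_
  gcongr
  exact le_mul_of_one_le_left (Real.sqrt_nonneg _) h2

end IsCordes

end FPK

end

theorem theorem2p12 {n : ℕ} (hn : 0 < n)
    (A : (Fin n → ℝ) → Matrix (Fin n) (Fin n) ℝ) (b : (Fin n → ℝ) → Fin n → ℝ)
    (lam Lam δ : ℝ) (hB : FPK.IsCordes A b lam Lam δ) :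
    (∃! r : FPK.L2per n, FPK.IsRenormFPKSol A b r) ∧
    (∃! ρ : FPK.H1perZero n, FPK.IsGalerkinSol A b ⊤ ρ) ∧
    0 < FPK.errConst lam Lam δ n ∧
    ∀ (r : FPK.L2per n) (ρ : FPK.H1perZero n),
      FPK.IsRenormFPKSol A b r → FPK.IsGalerkinSol A b ⊤ ρ →
      ∀ P : Submodule ℝ (FPK.H1perZero n), IsClosed (P : Set (FPK.H1perZero n)) →
        ∃ ρh : FPK.H1perZero n, FPK.IsGalerkinSol A b P ρh ∧
          (∀ ρ' : FPK.H1perZero n, FPK.IsGalerkinSol A b P ρ' → ρ' = ρh) ∧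
          ‖r - (Lp.const 2 (FPK.cellMeasure n) (1 : ℝ) - FPK.divg ρh)‖
            ≤ FPK.errConst lam Lam δ n * ⨅ w : P, ‖FPK.jac (ρ - (w : FPK.H1perZero n))‖ := by
  obtain ⟨ρ₀, hρ₀⟩ := hB.exists_isGalerkinSol hn (P := ⊤) isClosed_univ
  refine ⟨⟨_, hB.isRenormFPKSol_of_isGalerkinSol hn hρ₀,
    fun r hr => hB.isRenormFPKSol_unique hn (hB.isRenormFPKSol_of_isGalerkinSol hn hρ₀) hr⟩,
    ⟨ρ₀, hρ₀, fun ρ hρ => hB.isGalerkinSol_unique hn hρ₀ hρ⟩, hB.errConst_pos,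
    fun r ρ hr hρ P hP => ?_⟩
  obtain ⟨ρh, hρh⟩ := hB.exists_isGalerkinSol hn hP
  refine ⟨ρh, hρh, fun ρ' hρ' => hB.isGalerkinSol_unique hn hρh hρ', ?_⟩
  -- By uniqueness `r` is `1 - ∇·ρ`, so the constants cancel.
  have h1 : r - (FPK.constOne n - FPK.divg ρh) = -FPK.divg (ρ - ρh) := by
    rw [hB.isRenormFPKSol_unique hn (hB.isRenormFPKSol_of_isGalerkinSol hn hρ) hr,
      ← FPK.divgL_apply (ρ - ρh), map_sub, FPK.divgL_apply, FPK.divgL_apply]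
    abel
  rw [h1, norm_neg]
  exact hB.norm_divg_sub_le hn hρ hρh
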